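/- Let $d \ge 2$. For $f:\mathbb{Z}^d\to\mathbb{R}$ put $\Delta f(x) = 2d\,f(x) - \sum_{i=1}^d \left(f(x+e_i)+f(x-e_i)\right)$. Let $C^1(\mathbb{Z}^d)$ be the set of finitely supported integer-valued functions on $\mathbb{Z}^d$ whose values sum to $0$. The spectral parameter of $\mathbb{Z}^d$ with periodic boundary condition is $$\gamma_{\mathbb{Z}^d} = \inf\Big\{\sum_{x\in\mathbb{Z}^d} \left(1-\cos(2\pi\xi_x)\right) : \xi\in\ell^2(\mathbb{Z}^d),\ \Delta\xi\in C^1(\mathbb{Z}^d),\ \xi\not\equiv 0 \bmod 1\Big\}.$$ For $S\subset\{1,\dots,d\}$ let $\mathfrak{S}_S$ be the group generated by the reflections in the hyperplanes $\{x_i=0\}$, $i\in S$, and let $\mathscr{H}^2_S$ be the set of real-valued $\xi\in\ell^2(\mathbb{Z}^d)$ which are anti-symmetric under each of these reflections and for which $\Delta\xi$ is integer-valued. The spectral parameters with open boundary condition are, for $0\le j<d$, $$\gamma_{\mathbb{Z}^d,j} = \inf_{|S|=j}\ \inf_{\xi\in\mathscr{H}^2_S,\ \xi\not\equiv 0\bmod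 1}\ \sum_{x\in\mathbb{Z}^d/\mathfrak{S}_S}\left(1-\cos(2\pi\xi_x)\right),$$ and the spectral factors are $\Gamma_j = (d-j)/\gamma_{\mathbb{Z}^d,j}$ and $\Gamma=\max_{0\le j<d}\Gamma_j$. One says that the bulk behavior controls (dominates) the total variation mixing time of the sandpile dynamics with open boundary condition if $\Gamma=\Gamma_0$. **Theorem.** As $d\to\infty$, $$\gamma_{\mathbb{Z}^d} = \frac{\pi^2}{d^2}\left(1+\frac{1}{2d}+O(d^{-2})\right),$$ and for each fixed $j\ge 0$, $$\gamma_{\mathbb{Z}^d,j} = \frac{\pi^2}{2d^2}\left(1+\frac{3}{2d}+O_j(d^{-2})\right).$$ Uniformly in $j$, that is, for all $d\ge 2$ and all $0\le j<d$, $$\gamma_{\mathbb{Z}^d,j}\ge\frac{\pi^2}{2d^2+d}.$$ For each fixed $j\ge 0$, $$\Gamma_j=\frac{2d^3-(2j+3)d^2+O_j(d)}{\pi^2}.$$ In particular, for all sufficiently large $d$ the bulk behavior controls the total variation mixing time, i.e. $\Gamma=\Gamma_0$, and $\Gamma=\frac{2d^3}{\pi^2}\left(1-\frac{3}{2d}+O(d^{-2})\right)$.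 -/

import Mathlib

open Filter Asymptotics
open scoped ENNReal

namespace ZdSandpile

/-- The vertex set of the lattice `ℤ^d`. -/
abbrev Lattice (d : ℕ) : Type := Fin d → ℤ

/-- The graph Laplacian of the nearest neighbour graph on `ℤ^d` (every vertex has degree `2d`). -/
def laplacian {d : ℕ} (f : Lattice d → ℝ) (x : Lattice d) : ℝ :=
  2 * (d : ℝ) * f x - ∑ i : Fin d, (f (x + Pi.single i 1) + f (x - Pi.single i 1))

/-- `ξ` is not congruent to `0` modulo `1`: it takes some non-integer value. -/
def NonzeroModOne {d : ℕ} (ξ : Lattice d → ℝ) : Prop :=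
  ¬ ∀ x, ∃ n : ℤ, ξ x = n

/-- `f` lies in `C¹(ℤ^d)`: it is integer valued, finitely supported, and its values sum to `0`. -/
def IsC1 {d : ℕ} (f : Lattice d → ℝ) : Prop :=
  ∃ ν : Lattice d →₀ ℤ, (∀ x, f x = ν x) ∧ (ν.sum fun _ n => n) = 0

/-- `ξ` is a harmonic modulo 1 function: it is square summable with integer valued Laplacian. -/
def HarmonicModOne {d : ℕ} (ξ : Lattice d → ℝ) : Prop :=
  Memℓp ξ 2 ∧ ∀ x, ∃ n : ℤ, laplacian ξ x = n

/-- The term `1 - cos (2π t)`, as an extended nonnegative real. -/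
noncomputable def energy (t : ℝ) : ℝ≥0∞ :=
  ENNReal.ofReal (1 - Real.cos (2 * Real.pi * t))

/-- The reflection of `ℤ^d` in the coordinate hyperplane `x i = 0`. -/
def reflection {d : ℕ} (i : Fin d) : Equiv.Perm (Lattice d) :=
  Function.Involutive.toPerm (fun x => Function.update x i (-x i)) (fun x => by simp)

theorem reflection_apply {d : ℕ} (i : Fin d) (x : Lattice d) :
    reflection i x = Function.update x i (-x i) := rfl

/-- The group generated by the reflections in the hyperplanes `x i = 0`, `i ∈ S`. -/
def reflectionGroup {d : ℕ} (S : Finset (Fin d)) : Subgroup (Equiv.Perm (Lattice d)) :=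
  Subgroup.closure (reflection '' (S : Set (Fin d)))

/-- `ξ` changes sign under reflection in each of the hyperplanes `x i = 0`, `i ∈ S`. -/
def AntiSymmetric {d : ℕ} (S : Finset (Fin d)) (ξ : Lattice d → ℝ) : Prop :=
  ∀ i ∈ S, ∀ x, ξ (reflection i x) = -ξ x

/-- A set of representatives for the quotient of `ℤ^d` by the group of reflections in the
hyperplanes `x i = 0`, `i ∈ S`; see `existsUnique_representative`. -/
def quotientDomain {d : ℕ} (S : Finset (Fin d)) : Set (Lattice d) :=
  {x | ∀ i ∈ S, 0 ≤ x i}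

/-- Every orbit of the reflection group meets `quotientDomain S` in exactly one point. -/
theorem existsUnique_representative {d : ℕ} (S : Finset (Fin d)) (x : Lattice d) :
    ∃! y, y ∈ quotientDomain S ∧ ∃ σ ∈ reflectionGroup S, σ x = y := by
  have inv : ∀ σ ∈ reflectionGroup S, ∀ z : Lattice d,
      (∀ i ∈ S, |σ z i| = |z i|) ∧ ∀ i, i ∉ S → σ z i = z i := by
    intro σ hσ
    induction hσ using Subgroup.closure_induction with
    | mem σ h =>
      obtain ⟨j, hj, rfl⟩ := h
      have hj' : j ∈ S := hj
      intro z
      refine ⟨fun i _ => ?_, fun i hi => ?_⟩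
      · by_cases h : i = j
        · subst h; simp [reflection_apply]
        · simp [reflection_apply, h]
      · have : i ≠ j := fun h => hi (h ▸ hj')
        simp [reflection_apply, this]
    | one => intro z; simp
    | mul a b _ _ ha hb =>
      intro z
      refine ⟨fun i hi => ?_, fun i hi => ?_⟩
      · rw [Equiv.Perm.mul_apply, (ha (b z)).1 i hi, (hb z).1 i hi]
      · rw [Equiv.Perm.mul_apply, (ha (b z)).2 i hi, (hb z).2 i hi]
    | inv a _ ha =>
      intro z
      have h := ha (a⁻¹ z)
      rw [show a (a⁻¹ z) = z from a.apply_symm_apply z] at h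
      exact ⟨fun i hi => (h.1 i hi).symm, fun i hi => (h.2 i hi).symm⟩
  have ex : ∀ T : Finset (Fin d), T ⊆ S → ∃ σ ∈ reflectionGroup S,
      ∀ i ∈ T, 0 ≤ σ x i := by
    intro T
    induction T using Finset.induction_on with
    | empty => intro _; exact ⟨1, one_mem _, by simp⟩
    | insert j T hj ih =>
      intro hT
      obtain ⟨σ, hσ, h⟩ := ih fun i hi => hT (Finset.mem_insert_of_mem hi)
      by_cases hs : 0 ≤ σ x j
      · refine ⟨σ, hσ, fun i hi => ?_⟩
        rcases Finset.mem_insert.1 hi with rfl | hi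
        · exact hs
        · exact h i hi
      · refine ⟨reflection j * σ, mul_mem (Subgroup.subset_closure
          ⟨j, hT (Finset.mem_insert_self _ _), rfl⟩) hσ, fun i hi => ?_⟩
        rcases Finset.mem_insert.1 hi with rfl | hi
        · simp [reflection_apply]; omega
        · have : i ≠ j := fun e => hj (e ▸ hi)
          simpa [reflection_apply, this] using h i hi
  obtain ⟨σ, hσ, h⟩ := ex S (Finset.Subset.refl S)
  refine ⟨σ x, ⟨h, σ, hσ, rfl⟩, ?_⟩
  rintro y ⟨hy, τ, hτ, rfl⟩
  funext i
  by_cases hi : i ∈ S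
  · have h1 := (inv τ hτ x).1 i hi
    have h2 := (inv σ hσ x).1 i hi
    rw [← h2, abs_of_nonneg (hy i hi), abs_of_nonneg (h i hi)] at h1
    exact h1
  · rw [(inv τ hτ x).2 i hi, (inv σ hσ x).2 i hi]

/-- The spectral parameter `γ` of `ℤ^d` with periodic boundary condition: the infimum of
`∑ₓ (1 - cos (2π ξₓ))` over `ξ ∈ ℓ²(ℤ^d)` with `Δξ ∈ C¹(ℤ^d)` and `ξ ≢ 0 mod 1`. -/
noncomputable def gammaPeriodic (d : ℕ) : ℝ≥0∞ :=
  ⨅ (ξ : Lattice d → ℝ) (_ : Memℓp ξ 2 ∧ IsC1 (laplacian ξ) ∧ NonzeroModOne ξ),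
    ∑' x : Lattice d, energy (ξ x)

/-- The spectral parameter `γ_j` of `ℤ^d` with open boundary condition: the infimum, over the sets
`S` of `j` coordinates and the harmonic modulo 1 functions `ξ ≢ 0 mod 1` which are anti-symmetric
in the hyperplanes indexed by `S`, of the sum of `1 - cos (2π ξₓ)` over the quotient of `ℤ^d`
by the reflection group. -/
noncomputable def gammaOpen (d j : ℕ) : ℝ≥0∞ :=
  ⨅ (S : Finset (Fin d)) (_ : S.card = j),
    ⨅ (ξ : Lattice d → ℝ) (_ : HarmonicModOne ξ ∧ AntiSymmetric S ξ ∧ NonzeroModOne ξ),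
      ∑' x : quotientDomain S, energy (ξ x)

/-- The `j`th spectral factor `Γ_j = (d - j) / γ_j`. -/
noncomputable def spectralFactor (d j : ℕ) : ℝ :=
  ((d : ℝ) - j) / (gammaOpen d j).toReal

/-- `Γ = max {Γ_j : 0 ≤ j < d}`. -/
noncomputable def maxSpectralFactor (d : ℕ) : ℝ :=
  ⨆ j : Fin d, spectralFactor d j

/-- The bulk controls the total variation mixing time: `Γ = Γ_0`. -/
def BulkControlsMixing (d : ℕ) : Prop :=
  maxSpectralFactor d = spectralFactor d 0

end ZdSandpile

/-!
All spectral parameters are minima of `∑ (1 - cos (2π ξₓ))`, which to leading order is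
`2π² ∑ ξₓ²`, over functions with nonzero integral Laplacian `ν = Δξ`.

**Lower bounds.** After reducing `ξ` modulo `1` to an odd representative in `[-1/2, 1/2]` one still
has a square summable function with integral Laplacian `ν`, and `ν ≠ 0` since square summable
harmonic functions vanish (`eq_zero_of_laplacian_eq_zero`). For a finitely supported test function
`φ`, the Cauchy–Schwarz inequality gives `⟨φ, ν⟩² = ⟨Δφ, ξ⟩² ≤ ‖Δφ‖² ∑ ξₓ²`
(`pairing_laplacian_sq_le`), and `‖Δφ‖²` is computed by counting short walks. With open boundary a
charge in the fundamental domain has all its neighbours there. If one of the outward neighbours is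
charged as well, two point charges suffice; otherwise `φ = δ_x + d⁻¹ ∑ᵤ δ_{x+u}` gives the constant
`4d² - 6d + O(1)` (`laplacian_sq_le_of_isolated`). With periodic boundary the total charge is zero,
the extremal case is a dipole, and `φ = (1 + A / d) ν` with the adjacency operator `A` gives
`2d² - d + O(1)` (`dipole_sq_le`). Since the energy itself is small, `1 - cos` is close to its
quadratic approximation (`sq_le_one_sub_cos`, `ofReal_le_tsum_energy`).

**Upper bounds.** In Fourier space `Δ` is multiplication by `2d (1 - X)`, where `X` is the
characteristic function of a step of simple random walk, so by Parseval the solution of `Δξ = ν` has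
square norm `∫ |ν̂|² / (2d (1 - X))²` (`exists_solution`). For periodic boundary, averaging over the
dipoles `δ_0 - δ_{e_i}` gives `∫ (1 - X)⁻¹ / (2d²)` (`gammaPeriodic_le`). For open boundary a unit
charge is antisymmetrized; when it moves away from the hyperplanes, the Riemann–Lebesgue lemma shows
that the images decouple, which leaves `∫ (1 - X)⁻² / (4d²)` (`gammaOpen_le`). Expanding in powers
of `X`, which has vanishing odd moments and variance `1 / (2d)`, gives the stated expansions
(`exists_integral_inv_le`); the remainder is controlled by the eighth moment of `X` and a bound on
`∫ (1 - X)⁻⁴` uniform in `d`, which follows from the inequality of arithmetic and geometric means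
(`exists_integral_inv_pow_four_le`).

**Bulk dominance.** The uniform bound gives `π² Γ_j ≤ (d - 3)(2d² + d) = 2d³ - 5d² + O(d)` for
`j ≥ 3`, which is below `π² Γ_0 = 2d³ - 3d² + O(d)`; the cases `j = 1, 2` follow from the expansions
of `Γ_1` and `Γ_2`.
-/

namespace ZdSandpile

/-! ### Unit directions, the adjacency operator and walks -/

/-- The `2d` unit directions of the lattice `ℤ^d`: a coordinate and a sign. -/
abbrev Direction (d : ℕ) : Type := Fin d × Bool

/-- The unit vector pointing in a given direction. -/
def Direction.vec {d : ℕ} (u : Direction d) : Lattice d :=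
  Pi.single u.1 (if u.2 then 1 else -1)

/-- The direction opposite to `u`. -/
def Direction.opp {d : ℕ} (u : Direction d) : Direction d := (u.1, !u.2)

namespace Direction

variable {d : ℕ}

theorem vec_opp (u : Direction d) : u.opp.vec = -u.vec := by
  obtain ⟨i, b⟩ := u
  cases b <;> simp [vec, opp, ← Pi.single_neg]

theorem opp_opp (u : Direction d) : u.opp.opp = u := by
  simp [opp]

theorem vec_apply (u : Direction d) (i : Fin d) :
    u.vec i = if i = u.1 then (if u.2 then 1 else -1) else 0 := by
  simp [vec, Pi.single_apply]

theorem vec_injective : Function.Injective (vec (d := d)) := by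
  rintro ⟨i, a⟩ ⟨k, b⟩ h
  have h1 := congrFun h i
  have h2 := congrFun h k
  simp only [vec_apply] at h1 h2
  grind

theorem vec_ne_zero (u : Direction d) : u.vec ≠ 0 := by
  intro h
  have h1 := congrFun h u.1
  simp only [vec_apply, Pi.zero_apply] at h1
  grind

/-- A nonzero sum of two unit vectors determines the two vectors up to order. -/
theorem vec_add_eq {u v u' v' : Direction d} (h : u.vec + v.vec = u'.vec + v'.vec)
    (h0 : u.vec + v.vec ≠ 0) : (u = u' ∧ v = v') ∨ (u = v' ∧ v = u') := by
  obtain ⟨i, a⟩ := u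
  obtain ⟨k, b⟩ := v
  obtain ⟨i', a'⟩ := u'
  obtain ⟨k', b'⟩ := v'
  have h1 := congrFun h i
  have h2 := congrFun h k
  have h3 := congrFun h i'
  have h4 := congrFun h k'
  simp only [vec_apply, Pi.add_apply] at h1 h2 h3 h4
  have h5 : ¬ (i = k ∧ a ≠ b) := by
    rintro ⟨rfl, hab⟩
    apply h0
    funext l
    simp only [vec_apply, Pi.add_apply, Pi.zero_apply]
    cases a <;> cases b <;> grind
  simp only [Prod.mk.injEq]
  clear h h0
  grind (splits := 20)

theorem sum_vec (u : Direction d) : ∑ i, u.vec i = if u.2 then 1 else -1 := by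
  simp [vec_apply]

theorem card : Fintype.card (Direction d) = 2 * d := by
  simp [Direction, mul_comm]

end Direction

variable {d : ℕ}

/-- The adjacency operator of `ℤ^d`: the sum of a function over the neighbours of a vertex. -/
def adj (d : ℕ) : Module.End ℝ (Lattice d → ℝ) where
  toFun f x := ∑ u : Direction d, f (x + u.vec)
  map_add' f g := by funext x; simp [Finset.sum_add_distrib]
  map_smul' c f := by funext x; simp [Finset.mul_sum]

theorem adj_apply (f : Lattice d → ℝ) (x : Lattice d) :
    adj d f x = ∑ u : Direction d, f (x + u.vec) := rfl

theorem sum_direction {M : Type*} [AddCommMonoid M] (F : Lattice d → M) :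
    ∑ u : Direction d, F u.vec = ∑ i : Fin d, (F (Pi.single i 1) + F (-Pi.single i 1)) := by
  rw [Fintype.sum_prod_type]
  simp [Direction.vec, ← Pi.single_neg]

theorem laplacian_eq (f : Lattice d → ℝ) : laplacian f = (2 * d : ℝ) • f - adj d f := by
  funext x
  simp only [laplacian, Pi.sub_apply, Pi.smul_apply, smul_eq_mul, adj_apply]
  rw [sum_direction (fun v => f (x + v))]
  simp [sub_eq_add_neg]

theorem laplacian_apply (f : Lattice d → ℝ) (x : Lattice d) :
    laplacian f x = 2 * d * f x - ∑ u : Direction d, f (x + u.vec) := by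
  rw [laplacian_eq]; simp [adj_apply]

/-- The number of walks of length `k` between two vertices with difference `z`. -/
def walks (d k : ℕ) : Lattice d → ℝ := (adj d ^ k) (Pi.single 0 1)

theorem walks_zero (z : Lattice d) : walks d 0 z = if z = 0 then 1 else 0 := by
  simp [walks, Pi.single_apply]

theorem walks_succ (k : ℕ) (z : Lattice d) :
    walks d (k + 1) z = ∑ u : Direction d, walks d k (z + u.vec) := by
  simp only [walks]
  rw [pow_succ', Module.End.mul_apply, adj_apply]

theorem walks_nonneg (k : ℕ) (z : Lattice d) : 0 ≤ walks d k z := by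
  induction k generalizing z with
  | zero => rw [walks_zero]; split_ifs <;> norm_num
  | succ k ih => rw [walks_succ]; exact Finset.sum_nonneg fun u _ => ih _

theorem adj_pow_single (k : ℕ) (y z : Lattice d) :
    (adj d ^ k) (Pi.single y 1) z = walks d k (z - y) := by
  induction k generalizing z with
  | zero => simp [walks_zero, Pi.single_apply, sub_eq_zero]
  | succ k ih =>
    rw [pow_succ', Module.End.mul_apply, adj_apply, walks_succ]
    simp_rw [ih]
    refine Finset.sum_congr rfl fun u _ => ?_
    congr 1; abel

theorem walks_one_le (z : Lattice d) : walks d 1 z ≤ 1 := by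
  rw [walks_succ]
  simp only [walks_zero, Finset.sum_boole]
  norm_cast
  refine Finset.card_le_one.2 fun u hu v hv => ?_
  simp only [Finset.mem_filter, Finset.mem_univ, true_and] at hu hv
  exact Direction.vec_injective (add_left_cancel (hu.trans hv.symm))

theorem walks_one_eq (z : Lattice d) : walks d 1 z = 0 ∨ walks d 1 z = 1 := by
  rw [walks_succ]
  simp only [walks_zero, Finset.sum_boole]
  have h := walks_one_le z
  rw [walks_succ] at h
  simp only [walks_zero, Finset.sum_boole] at h
  norm_cast at h ⊢
  omega

theorem walks_one_zero : walks d 1 0 = 0 := by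
  rw [walks_succ]
  simp [walks_zero, Direction.vec_ne_zero]

theorem walks_one_vec (u : Direction d) : walks d 1 u.vec = 1 := by
  refine (walks_one_eq _).resolve_left fun h => ?_
  rw [walks_succ, Finset.sum_eq_zero_iff_of_nonneg (fun _ _ => walks_nonneg _ _)] at h
  have := h u.opp (Finset.mem_univ _)
  simp [walks_zero, Direction.vec_opp] at this

theorem walks_two_eq_card (z : Lattice d) : walks d 2 z =
    ((Finset.univ.filter fun p : Direction d × Direction d =>
      z + p.1.vec + p.2.vec = 0).card : ℝ) := by
  rw [walks_succ]
  simp_rw [walks_succ, walks_zero]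
  rw [← Fintype.sum_prod_type' (f := fun (a b : Direction d) =>
    if z + a.vec + b.vec = 0 then (1 : ℝ) else 0), Finset.sum_boole]

theorem walks_two_le {z : Lattice d} (hz : z ≠ 0) : walks d 2 z ≤ 2 := by
  rw [walks_two_eq_card]
  set s := Finset.univ.filter fun p : Direction d × Direction d => z + p.1.vec + p.2.vec = 0
  rcases s.eq_empty_or_nonempty with h | ⟨⟨u, v⟩, h⟩
  · simp [h]
  · have hs : s ⊆ {(u, v), (v, u)} := by
      rintro ⟨u', v'⟩ h'
      simp only [s, Finset.mem_filter, Finset.mem_univ, true_and, add_assoc] at h h'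
      have h1 := (eq_neg_of_add_eq_zero_right h)
      have h2 := (eq_neg_of_add_eq_zero_right h')
      have := Direction.vec_add_eq (h2.trans h1.symm) (by rw [h2]; simpa using hz)
      simp only [Finset.mem_insert, Finset.mem_singleton, Prod.mk.injEq]
      exact this
    exact_mod_cast (Finset.card_le_card hs).trans Finset.card_le_two

theorem walks_two_zero : walks d 2 0 = 2 * d := by
  rw [walks_succ]
  simp only [zero_add, walks_one_vec, Finset.sum_const, Finset.card_univ, Direction.card]
  simp

/-- Walks from a vertex to a neighbour have odd length, as they flip the parity of the coordinate
sum at each step. -/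
theorem walks_two_vec (u : Direction d) : walks d 2 u.vec = 0 := by
  rw [walks_two_eq_card, Nat.cast_eq_zero, Finset.card_eq_zero, Finset.filter_eq_empty_iff]
  rintro ⟨v, w⟩ - h
  have h1 := congrArg (fun x : Lattice d => ∑ i, x i) h
  simp only [Pi.add_apply, Finset.sum_add_distrib, Direction.sum_vec, Pi.zero_apply,
    Finset.sum_const_zero] at h1
  grind

theorem walks_three_le (hd : 1 ≤ d) (z : Lattice d) : walks d 3 z ≤ 6 * d := by
  have hd' : (1 : ℝ) ≤ d := by exact_mod_cast hd
  have h : ∀ w : Lattice d, walks d 2 w ≤ 2 + 2 * d * walks d 0 w := by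
    intro w
    by_cases hw : w = 0
    · subst hw; rw [walks_two_zero, walks_zero]; simp
    · rw [walks_zero, if_neg hw]; simpa using walks_two_le hw
  rw [walks_succ]
  calc ∑ u : Direction d, walks d 2 (z + u.vec)
      ≤ ∑ u : Direction d, (2 + 2 * d * walks d 0 (z + u.vec)) := Finset.sum_le_sum fun u _ => h _
    _ = 4 * d + 2 * d * walks d 1 z := by
        rw [Finset.sum_add_distrib, ← Finset.mul_sum, ← walks_succ]
        simp only [Finset.sum_const, Finset.card_univ, Direction.card]
        push_cast [nsmul_eq_mul]; ring
    _ ≤ 6 * d := by nlinarith [walks_one_le z]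

theorem walks_four_zero_le (hd : 1 ≤ d) : walks d 4 0 ≤ 12 * d ^ 2 := by
  rw [walks_succ]
  refine (Finset.sum_le_sum fun u _ => walks_three_le hd _).trans_eq ?_
  simp only [Finset.sum_const, Finset.card_univ, Direction.card]
  push_cast [nsmul_eq_mul]; ring

/-! ### Duality: testing the Laplacian -/

/-- The adjacency operator on finitely supported functions. -/
noncomputable def adjFinsupp (d : ℕ) : (Lattice d →₀ ℝ) →ₗ[ℝ] (Lattice d →₀ ℝ) :=
  Finsupp.linearCombination ℝ fun x => ∑ u : Direction d, Finsupp.single (x + u.vec) (1 : ℝ)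

theorem coe_adjFinsupp (φ : Lattice d →₀ ℝ) : ⇑(adjFinsupp d φ) = adj d φ := by
  induction φ using Finsupp.induction_linear with
  | zero => simp
  | add f g hf hg => rw [map_add, Finsupp.coe_add, hf, hg, Finsupp.coe_add, map_add]
  | single x a =>
    funext z
    simp only [adjFinsupp, Finsupp.linearCombination_single, Finsupp.smul_apply, smul_eq_mul,
      Finsupp.finsetSum_apply, adj_apply, Finsupp.single_apply, Finset.mul_sum, mul_ite, mul_one,
      mul_zero]
    have e : Function.Involutive (Direction.opp (d := d)) := Direction.opp_opp
    rw [← Equiv.sum_comp e.toPerm]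
    refine Finset.sum_congr rfl fun u _ => ?_
    simp only [Function.Involutive.coe_toPerm, Direction.vec_opp]
    refine if_congr ?_ rfl rfl
    rw [← sub_eq_add_neg, sub_eq_iff_eq_add]

/-- The Laplacian on finitely supported functions. -/
noncomputable def lapFinsupp (φ : Lattice d →₀ ℝ) : Lattice d →₀ ℝ :=
  (2 * d : ℝ) • φ - adjFinsupp d φ

theorem coe_lapFinsupp (φ : Lattice d →₀ ℝ) : ⇑(lapFinsupp φ) = laplacian φ := by
  rw [lapFinsupp, Finsupp.coe_sub, coe_adjFinsupp, laplacian_eq, Finsupp.coe_smul]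

/-- The pairing `∑ₓ φ(x) f(x)` of a finitely supported function with an arbitrary function. -/
noncomputable def pairing (f : Lattice d → ℝ) : (Lattice d →₀ ℝ) →ₗ[ℝ] ℝ :=
  Finsupp.linearCombination ℝ f

theorem pairing_single (f : Lattice d → ℝ) (x : Lattice d) (a : ℝ) :
    pairing f (Finsupp.single x a) = a * f x := by
  simp [pairing]

theorem pairing_eq_sum (f : Lattice d → ℝ) (φ : Lattice d →₀ ℝ) :
    pairing f φ = ∑ x ∈ φ.support, φ x * f x := by
  simp [pairing, Finsupp.linearCombination_apply, Finsupp.sum]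

theorem pairing_sub_smul (a : ℝ) (f g : Lattice d → ℝ) (φ : Lattice d →₀ ℝ) :
    pairing (a • f - g) φ = a * pairing f φ - pairing g φ := by
  simp only [pairing_eq_sum, Pi.sub_apply, Pi.smul_apply, smul_eq_mul, mul_sub,
    Finset.sum_sub_distrib, Finset.mul_sum]
  congr 1
  exact Finset.sum_congr rfl fun x _ => by ring

/-- The adjacency operator is symmetric. -/
theorem pairing_adjFinsupp (f : Lattice d → ℝ) (φ : Lattice d →₀ ℝ) :
    pairing f (adjFinsupp d φ) = pairing (adj d f) φ := by
  induction φ using Finsupp.induction_linear with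
  | zero => simp
  | add g h hg hh => rw [map_add, map_add, hg, hh, map_add]
  | single x a =>
    rw [adjFinsupp, Finsupp.linearCombination_single, map_smul, map_sum, pairing_single]
    simp [pairing_single, adj_apply]

/-- The Laplacian is symmetric. -/
theorem pairing_lapFinsupp (f : Lattice d → ℝ) (φ : Lattice d →₀ ℝ) :
    pairing f (lapFinsupp φ) = pairing (laplacian f) φ := by
  rw [lapFinsupp, map_sub, map_smul, pairing_adjFinsupp, laplacian_eq, pairing_sub_smul,
    smul_eq_mul]

/-- The duality estimate behind all lower bounds: testing `Δf` against a finitely supported `φ`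
bounds the square norm of `f` on the support of `Δφ` from below. -/
theorem pairing_laplacian_sq_le (f : Lattice d → ℝ) (φ : Lattice d →₀ ℝ) :
    pairing (laplacian f) φ ^ 2 ≤
      pairing (laplacian (laplacian φ)) φ * ∑ z ∈ (lapFinsupp φ).support, f z ^ 2 := by
  have h1 : pairing (laplacian (laplacian φ)) φ = ∑ z ∈ (lapFinsupp φ).support,
      lapFinsupp φ z ^ 2 := by
    rw [← coe_lapFinsupp φ, ← pairing_lapFinsupp, pairing_eq_sum]
    exact Finset.sum_congr rfl fun x _ => by ring
  rw [h1, ← pairing_lapFinsupp, pairing_eq_sum]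
  exact Finset.sum_mul_sq_le_sq_mul_sq _ _ _

/-- The kernel `⟨Δδ_x, Δδ_y⟩` of the squared Laplacian, as a function of `x - y`. -/
def biKernel (d : ℕ) (z : Lattice d) : ℝ :=
  4 * d ^ 2 * walks d 0 z - 4 * d * walks d 1 z + walks d 2 z

theorem laplacian_laplacian_single (y z : Lattice d) (a : ℝ) :
    laplacian (laplacian (Finsupp.single y a : Lattice d →₀ ℝ)) z = a * biKernel d (z - y) := by
  have h : ⇑(Finsupp.single y a : Lattice d →₀ ℝ) = a • Pi.single y (1 : ℝ) := by
    funext x; simp [Finsupp.single_apply, Pi.single_apply, eq_comm]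
  rw [laplacian_eq (laplacian _), laplacian_eq, h, biKernel, ← adj_pow_single 0,
    ← adj_pow_single 1, ← adj_pow_single 2]
  simp only [map_sub, map_smul, Pi.sub_apply, Pi.smul_apply, smul_eq_mul, pow_zero, pow_one,
    pow_two, Module.End.one_apply, Module.End.mul_apply]
  ring

theorem laplacian_add (f g : Lattice d → ℝ) : laplacian (f + g) = laplacian f + laplacian g := by
  rw [laplacian_eq, laplacian_eq, laplacian_eq, smul_add, map_add]; abel

theorem laplacian_zero : laplacian (0 : Lattice d → ℝ) = 0 := by
  rw [laplacian_eq]; simp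

theorem laplacian_sub (f g : Lattice d → ℝ) : laplacian (f - g) = laplacian f - laplacian g := by
  rw [laplacian_eq, laplacian_eq, laplacian_eq, smul_sub, map_sub]; abel

theorem biKernel_zero : biKernel d 0 = 4 * d ^ 2 + 2 * d := by
  simp [biKernel, walks_zero, walks_one_zero, walks_two_zero]

theorem biKernel_vec (u : Direction d) : biKernel d u.vec = -(4 * d) := by
  simp [biKernel, walks_zero, walks_one_vec, walks_two_vec, Direction.vec_ne_zero]

theorem biKernel_le_two {z : Lattice d} (hz : z ≠ 0) : biKernel d z ≤ 2 := by
  have h1 := walks_two_le hz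
  have h2 := walks_nonneg 1 z
  have h3 : (0 : ℝ) ≤ 4 * d * walks d 1 z := by positivity
  simp only [biKernel, walks_zero, hz, if_false]
  linarith

theorem abs_biKernel_le (hd : 1 ≤ d) {z : Lattice d} (hz : z ≠ 0) : |biKernel d z| ≤ 4 * d := by
  have hd' : (1 : ℝ) ≤ d := by exact_mod_cast hd
  rw [abs_le]
  refine ⟨?_, (biKernel_le_two hz).trans (by linarith)⟩
  simp only [biKernel, walks_zero, hz, if_false]
  nlinarith [walks_one_le z, walks_nonneg 2 z]

/-! ### Test functions made of point charges -/

theorem mem_support_lapFinsupp {φ : Lattice d →₀ ℝ} {z : Lattice d}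
    (hz : z ∈ (lapFinsupp φ).support) :
    z ∈ φ.support ∨ ∃ u : Direction d, z + u.vec ∈ φ.support := by
  by_contra! h
  rw [Finsupp.mem_support_iff, coe_lapFinsupp, laplacian_apply] at hz
  apply hz
  rw [Finsupp.notMem_support_iff.1 h.1, Finset.sum_eq_zero fun u _ =>
    Finsupp.notMem_support_iff.1 (h.2 u)]
  simp

/-- The finitely supported function with value `c a` at `p a`, for `a ∈ I`. -/
noncomputable def pointCharges {ι : Type*} (I : Finset ι) (p : ι → Lattice d) (c : ι → ℝ) :
    Lattice d →₀ ℝ :=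
  ∑ a ∈ I, Finsupp.single (p a) (c a)

section PointCharges

variable {ι : Type*} (I : Finset ι) (p : ι → Lattice d) (c : ι → ℝ)

theorem pairing_pointCharges (f : Lattice d → ℝ) :
    pairing f (pointCharges I p c) = ∑ a ∈ I, c a * f (p a) := by
  simp [pointCharges, pairing_single]

theorem mem_support_pointCharges {z : Lattice d} (hz : z ∈ (pointCharges I p c).support) :
    ∃ a ∈ I, p a = z := by
  by_contra! h
  rw [Finsupp.mem_support_iff, pointCharges, Finsupp.finsetSum_apply] at hz
  exact hz (Finset.sum_eq_zero fun a ha => by simp [h a ha])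

theorem laplacian_laplacian_pointCharges (z : Lattice d) :
    laplacian (laplacian (pointCharges I p c)) z = ∑ a ∈ I, c a * biKernel d (z - p a) := by
  classical
  unfold pointCharges
  induction I using Finset.induction_on with
  | empty => simp [laplacian_zero]
  | insert a I ha ih =>
    rw [Finset.sum_insert ha, Finset.sum_insert ha, Finsupp.coe_add, laplacian_add, laplacian_add,
      Pi.add_apply, ih, laplacian_laplacian_single]

theorem energy_pointCharges :
    pairing (laplacian (laplacian (pointCharges I p c))) (pointCharges I p c) =
      ∑ a ∈ I, ∑ b ∈ I, c a * c b * biKernel d (p a - p b) := by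
  rw [pairing_pointCharges]
  refine Finset.sum_congr rfl fun a _ => ?_
  rw [laplacian_laplacian_pointCharges, Finset.mul_sum]
  exact Finset.sum_congr rfl fun b _ => by ring

end PointCharges

theorem sum_sum_le_of_diag {ι : Type*} [DecidableEq ι] (I : Finset ι) (K : ι → ι → ℝ) {α β : ℝ}
    (h1 : ∀ a ∈ I, K a a ≤ α) (h2 : ∀ a ∈ I, ∀ b ∈ I, a ≠ b → K a b ≤ β) :
    ∑ a ∈ I, ∑ b ∈ I, K a b ≤ I.card * α + I.card * (I.card - 1) * β := by
  have h : ∀ a ∈ I, ∑ b ∈ I, K a b ≤ α + (I.card - 1) * β := by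
    intro a ha
    rw [← Finset.add_sum_erase _ _ ha]
    refine add_le_add (h1 a ha) ?_
    refine (Finset.sum_le_card_nsmul _ _ β fun b hb => ?_).trans_eq ?_
    · exact h2 a ha b (Finset.mem_of_mem_erase hb) (Finset.ne_of_mem_erase hb).symm
    · rw [Finset.card_erase_of_mem ha, nsmul_eq_mul,
        Nat.cast_pred (Finset.card_pos.2 ⟨a, ha⟩)]
  refine (Finset.sum_le_card_nsmul _ _ _ h).trans_eq ?_
  rw [nsmul_eq_mul]; ring

/-- Several charges: if `Δξ` is nonzero on `F`, testing against the signs of `Δξ` on `F` bounds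
`ξ` from below near `F`. -/
theorem sum_abs_laplacian_sq_le (hd : 1 ≤ d) (ξ : Lattice d → ℝ) (F : Finset (Lattice d)) :
    ∃ B : Finset (Lattice d), (∀ z ∈ B, z ∈ F ∨ ∃ u : Direction d, z + u.vec ∈ F) ∧
      (∑ x ∈ F, |laplacian ξ x|) ^ 2 ≤
        (F.card * (4 * d ^ 2 + 2 * d) + F.card * (F.card - 1) * (4 * d)) *
          ∑ z ∈ B, ξ z ^ 2 := by
  set c : Lattice d → ℝ := fun x => if 0 ≤ laplacian ξ x then 1 else -1 with hc
  have hc1 : ∀ x, |c x| = 1 := fun x => by simp only [hc]; split_ifs <;> simp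
  refine ⟨(lapFinsupp (pointCharges F id c)).support, fun z hz => ?_, ?_⟩
  · rcases mem_support_lapFinsupp hz with h | ⟨u, h⟩
    · obtain ⟨a, ha, rfl⟩ := mem_support_pointCharges _ _ _ h
      exact Or.inl ha
    · obtain ⟨a, ha, h⟩ := mem_support_pointCharges _ _ _ h
      exact Or.inr ⟨u, h ▸ ha⟩
  · have h1 : pairing (laplacian ξ) (pointCharges F id c) = ∑ x ∈ F, |laplacian ξ x| := by
      rw [pairing_pointCharges]
      refine Finset.sum_congr rfl fun x _ => ?_
      simp only [hc, id]
      split_ifs with h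
      · rw [abs_of_nonneg h, one_mul]
      · rw [abs_of_neg (not_le.1 h)]; ring
    rw [← h1]
    refine (pairing_laplacian_sq_le ξ _).trans ?_
    refine mul_le_mul_of_nonneg_right ?_ (Finset.sum_nonneg fun _ _ => sq_nonneg _)
    rw [energy_pointCharges]
    refine sum_sum_le_of_diag _ _ (fun a _ => ?_) fun a _ b _ hab => ?_
    · rw [sub_self, biKernel_zero, ← abs_mul_abs_self, hc1]; simp
    · refine (le_abs_self _).trans ?_
      rw [abs_mul, abs_mul, hc1, hc1, one_mul, one_mul]
      exact abs_biKernel_le hd (sub_ne_zero.2 hab)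

/-- The directions which do not point towards the hyperplanes indexed by `S`. -/
def outward (S : Finset (Fin d)) : Finset (Direction d) :=
  Finset.univ.filter fun u => ¬ (u.1 ∈ S ∧ u.2 = false)

theorem card_outward (S : Finset (Fin d)) : ((outward S).card : ℝ) = 2 * d - S.card := by
  have h1 : (Finset.univ.filter fun u : Direction d => u.1 ∈ S ∧ u.2 = false).card = S.card := by
    refine (Finset.card_bij (fun i _ => (i, false)) ?_ ?_ ?_).symm
    · intro i hi; simpa using hi
    · intro i _ k _ h; simpa using h
    · rintro ⟨i, b⟩ h; simp at h; exact ⟨i, h.1, by simp [h.2]⟩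
  have h2 := Finset.card_filter_add_card_filter_not (s := (Finset.univ : Finset (Direction d)))
    (fun u : Direction d => u.1 ∈ S ∧ u.2 = false)
  rw [Finset.card_univ, Direction.card, h1] at h2
  rw [outward, eq_sub_iff_add_eq']
  exact_mod_cast h2

theorem vec_nonneg_of_mem_outward {S : Finset (Fin d)} {u : Direction d} (hu : u ∈ outward S)
    {i : Fin d} (hi : i ∈ S) : 0 ≤ u.vec i := by
  simp only [outward, Finset.mem_filter, Finset.mem_univ, true_and, not_and] at hu
  rw [Direction.vec_apply]
  split_ifs with h1 h2
  · norm_num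
  · subst h1; exact absurd (by simpa using h2) (hu hi)
  · exact le_rfl

/-- An isolated charge: if `Δξ` vanishes at the outward neighbours of `x`, testing against
`δ_x + d⁻¹ ∑ᵤ δ_{x+u}` over the outward directions improves on testing against `δ_x`. -/
theorem laplacian_sq_le_of_isolated (hd : 1 ≤ d) (ξ : Lattice d → ℝ) (S : Finset (Fin d))
    (x : Lattice d) (h0 : ∀ u ∈ outward S, laplacian ξ (x + u.vec) = 0) :
    ∃ B : Finset (Lattice d), (∀ z ∈ B, ∃ v : Lattice d, (∀ i ∈ S, 0 ≤ v i) ∧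
        (z = x + v ∨ ∃ u : Direction d, z + u.vec = x + v)) ∧
      laplacian ξ x ^ 2 ≤ (4 * d ^ 2 + 2 * d - 4 * (2 * d - S.card) +
        (2 * d - S.card) * (2 * d + 2 * (2 * d - S.card) - 2) / d ^ 2) * ∑ z ∈ B, ξ z ^ 2 := by
  have hd' : (d : ℝ) ≠ 0 := by exact_mod_cast (by omega : d ≠ 0)
  set I := Finset.insertNone (outward S)
  set p : Option (Direction d) → Lattice d := fun a => x + a.elim 0 Direction.vec with hp
  set c : Option (Direction d) → ℝ := fun a => a.elim 1 fun _ => (d : ℝ)⁻¹ with hc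
  have hsupp : ∀ z ∈ (pointCharges I p c).support,
      ∃ v : Lattice d, (∀ i ∈ S, 0 ≤ v i) ∧ z = x + v := by
    intro z hz
    obtain ⟨a, ha, rfl⟩ := mem_support_pointCharges _ _ _ hz
    cases a with
    | none => exact ⟨0, by simp, rfl⟩
    | some u =>
      exact ⟨u.vec, fun i hi => vec_nonneg_of_mem_outward (Finset.some_mem_insertNone.1 ha) hi, rfl⟩
  refine ⟨(lapFinsupp (pointCharges I p c)).support, fun z hz => ?_, ?_⟩
  · rcases mem_support_lapFinsupp hz with h | ⟨u, h⟩
    · obtain ⟨v, hv, h⟩ := hsupp _ h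
      exact ⟨v, hv, Or.inl h⟩
    · obtain ⟨v, hv, h⟩ := hsupp _ h
      exact ⟨v, hv, Or.inr ⟨u, h⟩⟩
  · have h1 : pairing (laplacian ξ) (pointCharges I p c) = laplacian ξ x := by
      rw [pairing_pointCharges, Finset.sum_insertNone]
      rw [Finset.sum_eq_zero fun u hu => by simp [hp, h0 u hu]]
      simp [hp, hc]
    rw [← h1]
    refine (pairing_laplacian_sq_le ξ _).trans ?_
    refine mul_le_mul_of_nonneg_right ?_ (Finset.sum_nonneg fun _ _ => sq_nonneg _)
    rw [energy_pointCharges]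
    have hneg : ∀ u : Direction d, biKernel d (x + 0 - (x + u.vec)) = -(4 * d) := by
      intro u
      rw [← biKernel_vec u.opp, Direction.vec_opp]; congr 1; abel
    have hpos : ∀ u : Direction d, biKernel d (x + u.vec - (x + 0)) = -(4 * d) := by
      intro u
      rw [← biKernel_vec u]; congr 1; abel
    have h2 := sum_sum_le_of_diag (outward S)
      (fun u v => biKernel d (x + u.vec - (x + v.vec))) (α := 4 * d ^ 2 + 2 * d) (β := 2)
      (fun u _ => by rw [sub_self, biKernel_zero])
      (fun u _ v _ huv => biKernel_le_two fun h =>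
        huv (Direction.vec_injective (add_left_cancel (sub_eq_zero.1 h))))
    simp only [I, Finset.sum_insertNone, hp, hc, Option.elim, hneg, hpos, sub_self, biKernel_zero,
      Finset.sum_add_distrib, Finset.sum_const, nsmul_eq_mul, ← Finset.mul_sum]
    rw [card_outward] at h2 ⊢
    have h3 : (0 : ℝ) ≤ (d : ℝ)⁻¹ * (d : ℝ)⁻¹ := by positivity
    have h4 := mul_le_mul_of_nonneg_left h2 h3
    refine le_trans (add_le_add_right (add_le_add_right h4 _) _) (le_of_eq ?_)
    field_simp
    ring

/-! ### Antisymmetric functions on the fundamental domain -/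

theorem AntiSymmetric.eq_zero {S : Finset (Fin d)} {ξ : Lattice d → ℝ} (h : AntiSymmetric S ξ)
    {i : Fin d} (hi : i ∈ S) {x : Lattice d} (hx : x i = 0) : ξ x = 0 := by
  have h1 := h i hi x
  rw [reflection_apply, hx, neg_zero, ← hx, Function.update_eq_self] at h1
  linarith

theorem reflection_add (i : Fin d) (x y : Lattice d) :
    reflection i (x + y) = reflection i x + reflection i y := by
  funext k
  by_cases h : k = i
  · subst h; simp [reflection_apply]; ring
  · simp [reflection_apply, h]

theorem laplacian_comp_reflection (f : Lattice d → ℝ) (i : Fin d) (x : Lattice d) :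
    laplacian (fun y => f (reflection i y)) x = laplacian f (reflection i x) := by
  have e : Function.Involutive fun u : Direction d => if u.1 = i then u.opp else u := by
    intro u
    by_cases h : u.1 = i
    · simp only [h, if_true]
      rw [if_pos (by simpa [Direction.opp] using h), Direction.opp_opp]
    · simp [h]
  simp only [laplacian_apply]
  congr 1
  rw [← Equiv.sum_comp e.toPerm]
  refine Finset.sum_congr rfl fun u _ => ?_
  rw [reflection_add]
  congr 2
  simp only [Function.Involutive.coe_toPerm]
  funext k
  by_cases h : u.1 = i
  · simp only [h, if_true, reflection_apply, Direction.vec_opp]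
    by_cases hk : k = i
    · subst hk; simp
    · simp [hk, Direction.vec_apply, h]
  · simp only [h, if_false, reflection_apply]
    by_cases hk : k = i
    · subst hk; simp [Direction.vec_apply, Ne.symm h]
    · simp [hk]

theorem AntiSymmetric.laplacian {S : Finset (Fin d)} {ξ : Lattice d → ℝ}
    (h : AntiSymmetric S ξ) : AntiSymmetric S (laplacian ξ) := by
  intro i hi x
  rw [← laplacian_comp_reflection, funext (h i hi)]
  have : (fun x => -ξ x) = 0 - ξ := by funext x; simp
  rw [this, laplacian_sub, laplacian_zero]; simp

theorem one_le_of_laplacian_ne_zero {S : Finset (Fin d)} {ξ : Lattice d → ℝ}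
    (h : AntiSymmetric S ξ) {x : Lattice d} (hx : x ∈ quotientDomain S)
    (h0 : ZdSandpile.laplacian ξ x ≠ 0) {i : Fin d} (hi : i ∈ S) : 1 ≤ x i := by
  have h1 : 0 ≤ x i := hx i hi
  have h2 : x i ≠ 0 := fun e => h0 (h.laplacian.eq_zero hi e)
  omega

/-- If an antisymmetric function is nonzero somewhere, it is nonzero on the fundamental domain. -/
theorem AntiSymmetric.exists_mem_quotientDomain {S : Finset (Fin d)} {f : Lattice d → ℝ}
    (h : AntiSymmetric S f) {x : Lattice d} (hx : f x ≠ 0) :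
    ∃ y ∈ quotientDomain S, f y ≠ 0 := by
  obtain ⟨y, ⟨hy, σ, hσ, rfl⟩, -⟩ := existsUnique_representative S x
  refine ⟨σ x, hy, ?_⟩
  have key : ∀ z, |f (σ z)| = |f z| := by
    clear hy
    induction hσ using Subgroup.closure_induction with
    | mem σ hσ => obtain ⟨i, hi, rfl⟩ := hσ; intro z; rw [h i hi, abs_neg]
    | one => intro z; rfl
    | mul a b _ _ ha hb => intro z; rw [Equiv.Perm.mul_apply, ha, hb]
    | inv a _ ha => intro z; rw [← ha]; congr 2; exact a.apply_symm_apply z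
  rw [← abs_ne_zero, key, abs_ne_zero]
  exact hx

theorem add_mem_quotientDomain {S : Finset (Fin d)} {x z v : Lattice d}
    (hx : ∀ i ∈ S, 1 ≤ x i) (hv : ∀ i ∈ S, 0 ≤ v i)
    (h : z = x + v ∨ ∃ u : Direction d, z + u.vec = x + v) : z ∈ quotientDomain S := by
  intro i hi
  have h1 := hx i hi
  have h2 := hv i hi
  rcases h with rfl | ⟨u, h⟩
  · simp only [Pi.add_apply]; omega
  · have h3 := congrFun h i
    simp only [Pi.add_apply, Direction.vec_apply] at h3
    split_ifs at h3 <;> omega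

theorem one_le_abs_of_int {t : ℝ} (h : ∃ n : ℤ, t = n) (h0 : t ≠ 0) : 1 ≤ |t| := by
  obtain ⟨n, rfl⟩ := h
  have : n ≠ 0 := by exact_mod_cast h0
  exact_mod_cast Int.one_le_abs this

/-- The square norm on the fundamental domain of an antisymmetric function with nonzero integral
Laplacian is at least `1 / R`, where `R ≈ 4d² - 6d`. Two charges cost about twice as much as one,
so that the extremal case is an isolated unit charge. -/
theorem exists_finset_one_le (hd : 1 ≤ d) {S : Finset (Fin d)} {ξ : Lattice d → ℝ}
    (h : AntiSymmetric S ξ) (hint : ∀ x, ∃ n : ℤ, laplacian ξ x = n)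
    {x₀ : Lattice d} (hx₀ : laplacian ξ x₀ ≠ 0) {R : ℝ} (hR1 : 2 * d ^ 2 + 3 * d ≤ R)
    (hR2 : 4 * d ^ 2 + 2 * d - 4 * (2 * d - S.card) +
        (2 * d - S.card) * (2 * d + 2 * (2 * d - S.card) - 2) / d ^ 2 ≤ R) :
    ∃ B : Finset (Lattice d), (∀ z ∈ B, z ∈ quotientDomain S) ∧ 1 ≤ R * ∑ z ∈ B, ξ z ^ 2 := by
  obtain ⟨x, hxQ, hx⟩ := h.laplacian.exists_mem_quotientDomain hx₀
  have hx1 : ∀ i ∈ S, 1 ≤ x i := fun i hi => one_le_of_laplacian_ne_zero h hxQ hx hi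
  by_cases hiso : ∀ u ∈ outward S, laplacian ξ (x + u.vec) = 0
  · obtain ⟨B, hB, hle⟩ := laplacian_sq_le_of_isolated hd ξ S x hiso
    refine ⟨B, fun z hz => ?_, ?_⟩
    · obtain ⟨v, hv, h'⟩ := hB z hz
      exact add_mem_quotientDomain hx1 hv h'
    · have h1 : (1 : ℝ) ≤ laplacian ξ x ^ 2 := by
        rw [← sq_abs]; exact one_le_pow₀ (one_le_abs_of_int (hint x) hx)
      exact h1.trans (hle.trans (mul_le_mul_of_nonneg_right hR2
        (Finset.sum_nonneg fun _ _ => sq_nonneg _)))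
  · push Not at hiso
    obtain ⟨u, hu, hy⟩ := hiso
    have hyQ : x + u.vec ∈ quotientDomain S :=
      add_mem_quotientDomain hx1 (fun i hi => vec_nonneg_of_mem_outward hu hi) (Or.inl rfl)
    have hne : x ≠ x + u.vec := by simpa using (Direction.vec_ne_zero u)
    obtain ⟨B, hB, hle⟩ := sum_abs_laplacian_sq_le hd ξ {x, x + u.vec}
    have hin : ∀ w ∈ ({x, x + u.vec} : Finset (Lattice d)), ∀ i ∈ S, 1 ≤ w i := by
      intro w hw i hi
      simp only [Finset.mem_insert, Finset.mem_singleton] at hw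
      rcases hw with rfl | rfl
      · exact hx1 i hi
      · exact one_le_of_laplacian_ne_zero h hyQ hy hi
    refine ⟨B, fun z hz => ?_, ?_⟩
    · rcases hB z hz with h' | ⟨v, h'⟩
      · exact add_mem_quotientDomain (hin _ h') (v := 0) (by simp) (Or.inl (by simp))
      · exact add_mem_quotientDomain (hin _ h') (v := 0) (by simp) (Or.inr ⟨v, by simp⟩)
    · rw [Finset.sum_pair hne, Finset.card_pair hne] at hle
      have h1 := one_le_abs_of_int (hint x) hx
      have h2 := one_le_abs_of_int (hint _) hy
      have h3 : (4 : ℝ) ≤ (|laplacian ξ x| + |laplacian ξ (x + u.vec)|) ^ 2 := by nlinarith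
      have h4 : (0 : ℝ) ≤ ∑ z ∈ B, ξ z ^ 2 := Finset.sum_nonneg fun _ _ => sq_nonneg _
      have h5 := mul_le_mul_of_nonneg_right hR1 h4
      push_cast at hle
      nlinarith

/-! ### Reduction modulo one and lower bounds for open boundary -/

/-- The representative of `t` modulo `1` in `[-1/2, 1/2]`, chosen to be an odd function of `t`, so
that reduction modulo `1` preserves antisymmetry. -/
noncomputable def centered (t : ℝ) : ℝ :=
  if 0 ≤ t then t - round t else t + round (-t)

theorem centered_neg (t : ℝ) : centered (-t) = -centered t := by
  unfold centered
  rcases lt_trichotomy t 0 with h | rfl | h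
  · rw [if_pos (by linarith), if_neg (by linarith)]; ring
  · simp
  · rw [if_neg (by linarith), if_pos h.le, neg_neg]; ring

theorem exists_eq_centered_add (t : ℝ) : ∃ n : ℤ, t = centered t + n := by
  unfold centered
  split_ifs
  · exact ⟨round t, by ring⟩
  · exact ⟨-round (-t), by push_cast; ring⟩

theorem abs_centered_le_half (t : ℝ) : |centered t| ≤ 1 / 2 := by
  unfold centered
  split_ifs
  · exact abs_sub_round t
  · have := abs_sub_round (-t)
    rwa [← abs_neg, neg_sub, sub_neg_eq_add, add_comm] at this

theorem abs_centered_le_abs (t : ℝ) : |centered t| ≤ |t| := by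
  unfold centered
  split_ifs
  · simpa using round_le t 0
  · have := round_le (-t) 0
    rw [← abs_neg, neg_sub, sub_neg_eq_add, add_comm] at this
    simpa using this

theorem energy_centered (t : ℝ) : energy (centered t) = energy t := by
  obtain ⟨n, hn⟩ := exists_eq_centered_add t
  unfold energy
  conv_rhs => rw [hn]
  rw [show 2 * Real.pi * (centered t + n) = 2 * Real.pi * centered t + n * (2 * Real.pi) by ring,
    Real.cos_add_int_mul_two_pi]

theorem memℓp_two_iff {ι : Type*} {f : ι → ℝ} : Memℓp f 2 ↔ Summable fun x => f x ^ 2 := by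
  rw [memℓp_gen_iff (by norm_num)]
  simp

theorem memℓp_centered {ι : Type*} {f : ι → ℝ} (hf : Memℓp f 2) :
    Memℓp (fun x => centered (f x)) 2 := by
  rw [memℓp_two_iff] at hf ⊢
  exact hf.of_nonneg_of_le (fun _ => sq_nonneg _) fun x => sq_le_sq.2 (abs_centered_le_abs _)

theorem laplacian_int {f : Lattice d → ℝ} (hf : ∀ x, ∃ n : ℤ, f x = n) (x : Lattice d) :
    ∃ n : ℤ, laplacian f x = n := by
  choose g hg using hf
  refine ⟨2 * d * g x - ∑ u : Direction d, g (x + u.vec), ?_⟩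
  simp [laplacian_apply, hg]

theorem laplacian_centered_int {ξ : Lattice d → ℝ} (h : ∀ x, ∃ n : ℤ, laplacian ξ x = n)
    (x : Lattice d) : ∃ n : ℤ, laplacian (fun y => centered (ξ y)) x = n := by
  have h1 : ∀ y, ∃ n : ℤ, (ξ - fun y => centered (ξ y)) y = n := fun y => by
    obtain ⟨n, hn⟩ := exists_eq_centered_add (ξ y)
    exact ⟨n, by rw [Pi.sub_apply]; linarith⟩
  obtain ⟨a, ha⟩ := laplacian_int h1 x
  obtain ⟨b, hb⟩ := h x
  rw [laplacian_sub, Pi.sub_apply, hb] at ha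
  exact ⟨b - a, by push_cast; linarith⟩

theorem finite_sq_ge {ι : Type*} {f : ι → ℝ} (hf : Memℓp f 2) {ε : ℝ} (hε : 0 < ε) :
    {x | ε ≤ f x ^ 2}.Finite := by
  have h := (memℓp_two_iff.1 hf).tendsto_cofinite_zero
  have h1 := h.eventually (gt_mem_nhds hε)
  rw [eventually_cofinite] at h1
  simpa using h1

/-- A square summable harmonic function vanishes: among the finitely many points where `|ξ|` is
maximal, one has maximal first coordinate, but its right neighbour is also a maximum. -/
theorem eq_zero_of_laplacian_eq_zero (hd : 1 ≤ d) {ξ : Lattice d → ℝ} (hξ : Memℓp ξ 2)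
    (h : ∀ x, laplacian ξ x = 0) : ξ = 0 := by
  by_contra hne
  obtain ⟨x₀, hx₀⟩ := Function.ne_iff.1 hne
  have hfin := finite_sq_ge hξ (ε := ξ x₀ ^ 2) (by have := sq_pos_of_ne_zero hx₀; simpa using this)
  obtain ⟨x₁, hx₁, hmax⟩ := Set.exists_max_image _ (fun x => ξ x ^ 2) hfin ⟨x₀, le_refl (ξ x₀ ^ 2)⟩
  have hmax' : ∀ x, ξ x ^ 2 ≤ ξ x₁ ^ 2 := fun x => by
    by_cases hx : ξ x₀ ^ 2 ≤ ξ x ^ 2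
    · exact hmax x hx
    · exact (not_le.1 hx).le.trans hx₁
  have hfin2 : {x | ξ x ^ 2 = ξ x₁ ^ 2}.Finite := hfin.subset fun x hx => by
    simp only [Set.mem_ofPred_eq] at hx hx₁ ⊢; rw [hx]; exact hx₁
  set i : Fin d := ⟨0, hd⟩
  obtain ⟨x₂, hx₂, hmax₂⟩ := Set.exists_max_image _ (fun x : Lattice d => x i) hfin2 ⟨x₁, rfl⟩
  simp only [Set.mem_ofPred_eq] at hx₂ hmax₂
  -- equality in the mean value property forces `ξ` to be constant around a maximum
  have hconst : ∑ u : Direction d, (ξ x₂ - ξ (x₂ + u.vec)) ^ 2 ≤ 0 := by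
    have h1 := h x₂
    rw [laplacian_apply] at h1
    have h2 : ∑ u : Direction d, (ξ x₂ - ξ (x₂ + u.vec)) ^ 2 ≤
        ∑ u : Direction d, (2 * ξ x₂ ^ 2 - 2 * ξ x₂ * ξ (x₂ + u.vec)) :=
      Finset.sum_le_sum fun u _ => by nlinarith [hmax' (x₂ + u.vec)]
    rw [Finset.sum_sub_distrib,
      ← Finset.mul_sum Finset.univ (fun u : Direction d => ξ (x₂ + u.vec))] at h2
    simp only [Finset.sum_const, Finset.card_univ, Direction.card, nsmul_eq_mul] at h2
    push_cast at h2
    have h3 : ∑ u : Direction d, ξ (x₂ + u.vec) = 2 * d * ξ x₂ := by linarith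
    rw [h3] at h2
    linarith
  have h4 := (Finset.sum_eq_zero_iff_of_nonneg fun u _ => sq_nonneg _).1
    (le_antisymm hconst (Finset.sum_nonneg fun u _ => sq_nonneg _)) (i, true) (Finset.mem_univ _)
  have h5 : ξ (x₂ + Direction.vec (i, true)) = ξ x₂ := by
    have := pow_eq_zero_iff (two_ne_zero) |>.1 h4; linarith
  have h6 := hmax₂ _ (by rw [h5, hx₂])
  simp [Direction.vec_apply] at h6

theorem two_pi_sq_mul_le_one_sub_cos {t : ℝ} (ht : |t| ≤ 1 / 2) :
    2 * Real.pi ^ 2 * t ^ 2 * (1 - Real.pi ^ 2 * t ^ 2 / 3) ≤ 1 - Real.cos (2 * Real.pi * t) := by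
  have hpi := Real.pi_pos
  have hpi4 := Real.pi_lt_four
  rw [← sq_abs t, ← Real.cos_abs, abs_mul, abs_of_pos (by positivity : 0 < 2 * Real.pi)]
  have h0 := abs_nonneg t
  generalize |t| = s at *
  rw [show 2 * Real.pi * s = 2 * (Real.pi * s) by ring, Real.cos_two_mul, Real.cos_sq']
  have h1 : Real.pi * s - (Real.pi * s) ^ 3 / 6 ≤ Real.sin (Real.pi * s) := by
    rcases h0.eq_or_lt with rfl | h
    · simp
    · exact (Real.sin_gt_sub_cube (by positivity)).le
  have h2 : Real.pi * s ≤ 2 := by nlinarith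
  have h3 : 0 ≤ Real.pi * s := by positivity
  have h4 : 0 ≤ Real.pi * s - (Real.pi * s) ^ 3 / 6 := by
    nlinarith [mul_nonneg h3 (by nlinarith : (0 : ℝ) ≤ 4 - (Real.pi * s) ^ 2)]
  have h5 := pow_le_pow_left₀ h4 h1 2
  nlinarith [pow_nonneg h3 6, sq_nonneg ((Real.pi * s) ^ 3)]

/-- The quadratic lower bound for `1 - cos`, with an error controlled by a bound on its value. -/
theorem sq_le_one_sub_cos {t A : ℝ} (ht : |t| ≤ 1 / 2) (hA : A < 1)
    (h : 1 - Real.cos (2 * Real.pi * t) ≤ A) :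
    2 * Real.pi ^ 2 * (1 - A / (19 / 4)) * t ^ 2 ≤ 1 - Real.cos (2 * Real.pi * t) := by
  have hpi := Real.pi_pos
  have hpi2 : Real.pi ^ 2 < 9.8698 := by nlinarith [Real.pi_lt_d6]
  have h1 : |t| ≤ 1 / 4 := by
    by_contra! h1
    have : Real.cos (2 * Real.pi * t) ≤ 0 := by
      rw [← Real.cos_abs, abs_mul, abs_of_pos (by positivity : 0 < 2 * Real.pi)]
      exact Real.cos_nonpos_of_pi_div_two_le_of_le (by nlinarith) (by nlinarith)
    linarith
  have h2 : t ^ 2 ≤ 1 / 16 := by rw [← sq_abs]; nlinarith [abs_nonneg t]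
  have h3 := two_pi_sq_mul_le_one_sub_cos ht
  set C := 1 - Real.cos (2 * Real.pi * t)
  have h4 : 0 ≤ Real.pi ^ 2 * t ^ 2 := by positivity
  have h5 : Real.pi ^ 2 * t ^ 2 / 3 ≤ 5 / 24 := by nlinarith
  have h6 : 2 * (Real.pi ^ 2 * t ^ 2) * (19 / 24) ≤ C := by nlinarith
  -- `19 / 4 = 3 * 2 * (19 / 24)`
  have h7 : Real.pi ^ 2 * t ^ 2 / 3 ≤ A / (19 / 4) := by linarith
  nlinarith

theorem ofReal_sum_le_tsum_energy {Q : Set (Lattice d)} (ξ : Lattice d → ℝ)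
    {B : Finset (Lattice d)} (hB : ∀ z ∈ B, z ∈ Q) :
    ENNReal.ofReal (∑ z ∈ B, (1 - Real.cos (2 * Real.pi * ξ z))) ≤ ∑' x : Q, energy (ξ x) := by
  rw [ENNReal.ofReal_sum_of_nonneg fun z _ => by linarith [Real.cos_le_one (2 * Real.pi * ξ z)],
    tsum_subtype Q fun x => energy (ξ x)]
  refine le_trans (Finset.sum_le_sum fun z hz => ?_) (ENNReal.sum_le_tsum B)
  rw [Set.indicator_of_mem (hB z hz)]
  rfl

/-- A lower bound `1 / R` on a local square norm turns into a lower bound on the energy. If the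
energy were below `L ≤ A`, so would be each of its terms, and the quadratic approximation of
`1 - cos` would hold with relative error `A / (19 / 4)`. -/
theorem ofReal_le_tsum_energy {Q : Set (Lattice d)} {ξ : Lattice d → ℝ}
    (hξ : ∀ x, |ξ x| ≤ 1 / 2) {B : Finset (Lattice d)} (hB : ∀ z ∈ B, z ∈ Q) {R A L : ℝ}
    (hR : 0 < R) (h1 : 1 ≤ R * ∑ z ∈ B, ξ z ^ 2) (hA : A < 1) (hLA : L ≤ A)
    (hL : L * R ≤ 2 * Real.pi ^ 2 * (1 - A / (19 / 4))) :
    ENNReal.ofReal L ≤ ∑' x : Q, energy (ξ x) := by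
  refine le_trans (ENNReal.ofReal_le_ofReal ?_) (ofReal_sum_le_tsum_energy ξ hB)
  have hnn : ∀ z, 0 ≤ 1 - Real.cos (2 * Real.pi * ξ z) := fun z => by
    linarith [Real.cos_le_one (2 * Real.pi * ξ z)]
  by_contra! hlt
  have h2 : ∑ z ∈ B, 2 * Real.pi ^ 2 * (1 - A / (19 / 4)) * ξ z ^ 2 ≤
      ∑ z ∈ B, (1 - Real.cos (2 * Real.pi * ξ z)) :=
    Finset.sum_le_sum fun z hz => sq_le_one_sub_cos (hξ z) hA
      ((Finset.single_le_sum (fun z _ => hnn z) hz).trans (hlt.le.trans hLA))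
  rw [← Finset.mul_sum] at h2
  have h3 : 0 ≤ 2 * Real.pi ^ 2 * (1 - A / (19 / 4)) := by
    have : 0 ≤ 1 - A / (19 / 4) := by linarith
    positivity
  nlinarith [mul_le_mul_of_nonneg_left h1 h3]

/-- Lower bound for the spectral parameters with open boundary, in terms of the constant `R` of
`exists_finset_one_le`. -/
theorem ofReal_le_gammaOpen (hd : 1 ≤ d) {j : ℕ} {R A L : ℝ} (hR1 : 2 * d ^ 2 + 3 * d ≤ R)
    (hR2 : 4 * d ^ 2 + 2 * d - 4 * (2 * d - j) +
        (2 * d - j) * (2 * d + 2 * (2 * d - j) - 2) / d ^ 2 ≤ R)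
    (hA : A < 1) (hLA : L ≤ A) (hL : L * R ≤ 2 * Real.pi ^ 2 * (1 - A / (19 / 4))) :
    ENNReal.ofReal L ≤ gammaOpen d j := by
  refine le_iInf₂ fun S hS => le_iInf₂ fun ξ hξ => ?_
  obtain ⟨⟨hmem, hint⟩, hanti, hne⟩ := hξ
  subst hS
  have hd' : (1 : ℝ) ≤ d := by exact_mod_cast hd
  set η : Lattice d → ℝ := fun x => centered (ξ x) with hη
  have hηS : AntiSymmetric S η := fun i hi x => by
    simp only [hη]; rw [hanti i hi, centered_neg]
  have hηl : ∃ x, laplacian η x ≠ 0 := by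
    by_contra! h0
    have h1 := eq_zero_of_laplacian_eq_zero hd (memℓp_centered hmem) h0
    refine hne fun x => ?_
    obtain ⟨n, hn⟩ := exists_eq_centered_add (ξ x)
    have h2 : centered (ξ x) = 0 := congrFun h1 x
    exact ⟨n, by rw [hn, h2, zero_add]⟩
  obtain ⟨x₀, hx₀⟩ := hηl
  obtain ⟨B, hB, hle⟩ := exists_finset_one_le hd hηS (laplacian_centered_int hint) hx₀ hR1 hR2
  have h := ofReal_le_tsum_energy (fun x => abs_centered_le_half (ξ x)) hB (by nlinarith) hle hA
    hLA hL
  simpa only [hη, energy_centered] using h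

/-- The uniform lower bound for the spectral parameters with open boundary. -/
theorem pi_sq_div_le_gammaOpen (hd : 2 ≤ d) {j : ℕ} (hj : j < d) :
    ENNReal.ofReal (Real.pi ^ 2 / (2 * (d : ℝ) ^ 2 + d)) ≤ gammaOpen d j := by
  have hd' : (2 : ℝ) ≤ d := by exact_mod_cast hd
  have hj' : (j : ℝ) + 1 ≤ d := by exact_mod_cast hj
  have hj0 : (0 : ℝ) ≤ j := Nat.cast_nonneg _
  have hpi2 : Real.pi ^ 2 < 9.8698 := by nlinarith [Real.pi_lt_d6, Real.pi_pos]
  have hpi0 : 0 < Real.pi ^ 2 := by positivity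
  have hq : 0 < 2 * (d : ℝ) ^ 2 + d := by positivity
  -- the gain `9 / 2` over the bound `4 d² + 2 d` of a single test charge absorbs the quartic error
  -- in `1 - cos`, as `2 π² / (19 / 4) < 9 / 2`
  refine ofReal_le_gammaOpen (R := 4 * d ^ 2 + 2 * d - 9 / 2) (by omega) (by nlinarith) ?_ ?_
    le_rfl ?_
  · have h1 : (2 * d - j : ℝ) * (2 * d + 2 * (2 * d - j) - 2) / d ^ 2 ≤ (2 * d - j) * (5 / 2) := by
      rw [div_le_iff₀ (by positivity), mul_assoc]
      exact mul_le_mul_of_nonneg_left (by nlinarith) (by linarith)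
    nlinarith
  · rw [div_lt_one hq]; nlinarith
  · rw [div_mul_eq_mul_div, div_le_iff₀ hq, mul_assoc, mul_assoc]
    have h1 : Real.pi ^ 2 / (2 * (d : ℝ) ^ 2 + d) * (2 * d ^ 2 + d) = Real.pi ^ 2 :=
      div_mul_cancel₀ _ hq.ne'
    have h2 : (1 - Real.pi ^ 2 / (2 * (d : ℝ) ^ 2 + d) / (19 / 4)) * (2 * d ^ 2 + d) =
        2 * d ^ 2 + d - Real.pi ^ 2 / (19 / 4) := by
      rw [sub_mul, div_mul_eq_mul_div, h1, one_mul]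
    rw [h2]
    nlinarith

/-! ### Dipoles and the lower bound for periodic boundary -/

theorem walks_neg (k : ℕ) (z : Lattice d) : walks d k (-z) = walks d k z := by
  induction k generalizing z with
  | zero => simp [walks_zero]
  | succ k ih =>
    have e : Function.Involutive (Direction.opp (d := d)) := Direction.opp_opp
    rw [walks_succ, walks_succ, ← Equiv.sum_comp e.toPerm]
    refine Finset.sum_congr rfl fun u _ => ?_
    rw [← ih, Function.Involutive.coe_toPerm, Direction.vec_opp, neg_add, neg_neg, neg_neg]

theorem adj_pow_dipole (k : ℕ) (x y z : Lattice d) :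
    (adj d ^ k) ⇑(Finsupp.single x 1 - Finsupp.single y 1 : Lattice d →₀ ℝ) z =
      walks d k (z - x) - walks d k (z - y) := by
  have h : ∀ w : Lattice d, ⇑(Finsupp.single w 1 : Lattice d →₀ ℝ) = Pi.single w (1 : ℝ) := by
    intro w; funext x; simp [Finsupp.single_apply, Pi.single_apply, eq_comm]
  rw [Finsupp.coe_sub, h, h, map_sub, Pi.sub_apply, adj_pow_single, adj_pow_single]

/-- The dipole: if `Δξ = δ_x - δ_y`, testing against `(1 + A / d) (δ_x - δ_y)`, with `A` the
adjacency operator, gives a bound which is weakest when `x` and `y` are neighbours. -/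
theorem dipole_sq_le (hd : 1 ≤ d) {ξ : Lattice d → ℝ} {x y : Lattice d} (hxy : x ≠ y)
    (h : laplacian ξ = ⇑(Finsupp.single x 1 - Finsupp.single y 1 : Lattice d →₀ ℝ)) :
    ∃ B : Finset (Lattice d), (2 - 2 * walks d 1 (x - y) / d) ^ 2 ≤
      (8 * d ^ 2 - 12 * d - 8 * d * walks d 1 (x - y) + 60) * ∑ z ∈ B, ξ z ^ 2 := by
  have hd' : (1 : ℝ) ≤ d := by exact_mod_cast hd
  have hd0 : (d : ℝ) ≠ 0 := by positivity
  set φ₀ : Lattice d →₀ ℝ := Finsupp.single x 1 - Finsupp.single y 1 with hφ₀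
  set φ : Lattice d →₀ ℝ := φ₀ + (d : ℝ)⁻¹ • adjFinsupp d φ₀ with hφ
  have hcoe : ⇑φ = ⇑φ₀ + (d : ℝ)⁻¹ • adj d φ₀ := by
    rw [hφ, Finsupp.coe_add, Finsupp.coe_smul, coe_adjFinsupp]
  have hpair : ∀ f : Lattice d → ℝ,
      pairing f φ = f x - f y + (d : ℝ)⁻¹ * (adj d f x - adj d f y) := by
    intro f
    rw [hφ, map_add, map_smul, pairing_adjFinsupp, hφ₀, map_sub, map_sub]
    simp [pairing_single]
  have hneg : ∀ k, walks d k (y - x) = walks d k (x - y) := fun k => by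
    rw [← walks_neg, neg_sub]
  have hdiff : ∀ k, (adj d ^ k) φ₀ x - (adj d ^ k) φ₀ y =
      2 * (walks d k 0 - walks d k (x - y)) := by
    intro k
    rw [hφ₀, adj_pow_dipole, adj_pow_dipole, sub_self, sub_self, hneg]; ring
  have h0 := hdiff 0
  have h1 := hdiff 1
  have h2 := hdiff 2
  have h3 := hdiff 3
  have h4 := hdiff 4
  simp only [pow_succ, pow_zero, one_mul, Module.End.mul_apply, Module.End.one_apply]
    at h0 h1 h2 h3 h4
  rw [walks_zero, walks_zero, if_pos rfl, if_neg (sub_ne_zero.2 hxy)] at h0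
  rw [walks_one_zero] at h1
  rw [walks_two_zero] at h2
  have hw2 := walks_two_le (sub_ne_zero.2 hxy)
  have hw3 := walks_three_le hd (x - y)
  have hw30 := walks_nonneg 3 (0 : Lattice d)
  have hw4 := walks_nonneg 4 (x - y)
  have hw40 := walks_four_zero_le (d := d) hd
  refine ⟨(lapFinsupp φ).support, ?_⟩
  have key := pairing_laplacian_sq_le ξ φ
  have e1 : pairing (laplacian ξ) φ = 2 - 2 * walks d 1 (x - y) / d := by
    rw [hpair, h, h0, h1]; field_simp; ring
  have e2 : pairing (laplacian (laplacian φ)) φ ≤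
      8 * d ^ 2 - 12 * d - 8 * d * walks d 1 (x - y) + 60 := by
    rw [hpair, hcoe, laplacian_eq (laplacian _), laplacian_eq]
    simp only [map_sub, map_add, map_smul, Pi.sub_apply, Pi.add_apply, Pi.smul_apply, smul_eq_mul]
    have e3 : ∀ a0 a1 a2 a3 a4 b0 b1 b2 b3 b4 : ℝ,
        2 * d * (2 * d * (a0 + (d : ℝ)⁻¹ * a1) - (a1 + (d : ℝ)⁻¹ * a2)) -
          (2 * d * (a1 + (d : ℝ)⁻¹ * a2) - (a2 + (d : ℝ)⁻¹ * a3)) -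
        (2 * d * (2 * d * (b0 + (d : ℝ)⁻¹ * b1) - (b1 + (d : ℝ)⁻¹ * b2)) -
          (2 * d * (b1 + (d : ℝ)⁻¹ * b2) - (b2 + (d : ℝ)⁻¹ * b3))) +
        (d : ℝ)⁻¹ * (2 * d * (2 * d * (a1 + (d : ℝ)⁻¹ * a2) - (a2 + (d : ℝ)⁻¹ * a3)) -
          (2 * d * (a2 + (d : ℝ)⁻¹ * a3) - (a3 + (d : ℝ)⁻¹ * a4)) -
        (2 * d * (2 * d * (b1 + (d : ℝ)⁻¹ * b2) - (b2 + (d : ℝ)⁻¹ * b3)) -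
          (2 * d * (b2 + (d : ℝ)⁻¹ * b3) - (b3 + (d : ℝ)⁻¹ * b4)))) =
        4 * d ^ 2 * (a0 - b0) + 4 * d * (a1 - b1) - 3 * (a2 - b2) - 2 / d * (a3 - b3) +
          1 / d ^ 2 * (a4 - b4) := by
      intros; field_simp; ring
    rw [e3, h0, h1, h2, h3, h4]
    have i3 : 2 / d * (2 * (walks d 3 0 - walks d 3 (x - y))) ≥ -24 := by
      rw [ge_iff_le, div_mul_eq_mul_div, le_div_iff₀ (by positivity)]; linarith
    have i4 : 1 / d ^ 2 * (2 * (walks d 4 0 - walks d 4 (x - y))) ≤ 24 := by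
      rw [div_mul_eq_mul_div, div_le_iff₀ (by positivity)]; linarith
    linarith
  rw [e1] at key
  exact key.trans (mul_le_mul_of_nonneg_right e2 (Finset.sum_nonneg fun _ _ => sq_nonneg _))

/-- The class `C¹` is stable under reduction of `ξ` modulo `1`: an integer valued `ℓ²` function is
finitely supported, so that its Laplacian has total charge zero. -/
theorem exists_finsupp_laplacian_centered {ξ : Lattice d → ℝ} (hξ : Memℓp ξ 2)
    (h : IsC1 (laplacian ξ)) : ∃ ν : Lattice d →₀ ℝ,
      ⇑ν = laplacian (fun x => centered (ξ x)) ∧ ∑ x ∈ ν.support, ν x = 0 := by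
  obtain ⟨ν, hν, hsum⟩ := h
  have hmem : Memℓp (ξ - fun x => centered (ξ x)) 2 := hξ.sub (memℓp_centered hξ)
  have hfin : (Function.support (ξ - fun x => centered (ξ x))).Finite := by
    refine (finite_sq_ge hmem one_pos).subset fun x hx => ?_
    obtain ⟨n, hn⟩ := exists_eq_centered_add (ξ x)
    have h1 : (ξ - fun x => centered (ξ x)) x = n := by rw [Pi.sub_apply]; linarith
    rw [Set.mem_ofPred_eq, ← sq_abs]
    exact one_le_pow₀ (one_le_abs_of_int ⟨n, h1⟩ hx)
  set κ := Finsupp.ofSupportFinite _ hfin with hκ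
  have hone : ∀ φ : Lattice d →₀ ℝ, ∑ x ∈ φ.support, φ x = pairing (fun _ => 1) φ := fun φ => by
    simp [pairing_eq_sum]
  have hν' : ⇑(ν.mapRange ((↑) : ℤ → ℝ) Int.cast_zero) = laplacian ξ := by
    funext x; simp [hν]
  refine ⟨ν.mapRange (↑) Int.cast_zero - lapFinsupp κ, ?_, ?_⟩
  · have hκ' : ⇑κ = ξ - fun x => centered (ξ x) := rfl
    rw [Finsupp.coe_sub, hν', coe_lapFinsupp, hκ', laplacian_sub]; abel
  · rw [hone, map_sub, pairing_lapFinsupp, ← hone]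
    have h1 : laplacian (fun _ : Lattice d => (1 : ℝ)) = 0 := by
      funext x; simp [laplacian]; ring
    have h2 : pairing (0 : Lattice d → ℝ) κ = 0 := by simp [pairing_eq_sum]
    rw [h1, h2, sub_zero]
    have h3 := Finsupp.sum_mapRange_index (f := ((↑) : ℤ → ℝ)) (hf := Int.cast_zero) (g := ν)
      (h := fun _ b => b) (fun _ => rfl)
    change Finsupp.sum _ (fun _ b => b) = 0
    rw [h3, Finsupp.sum, ← Int.cast_sum]
    exact_mod_cast hsum

/-- A nonzero integral `Δξ` of total charge zero has at least three charges, a multiple charge, or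
is a dipole; the dipole of two neighbours is the extremal case. -/
theorem exists_finset_one_le_of_sum_eq_zero (hd : 3 ≤ d) {ξ : Lattice d → ℝ}
    (hint : ∀ x, ∃ n : ℤ, laplacian ξ x = n) {ν : Lattice d →₀ ℝ} (hν : ⇑ν = laplacian ξ)
    (hsum : ∑ x ∈ ν.support, ν x = 0) (h0 : ν ≠ 0) :
    ∃ B : Finset (Lattice d), 1 ≤ (2 * (d : ℝ) ^ 2 - d + 100) * ∑ z ∈ B, ξ z ^ 2 := by
  have hd' : (3 : ℝ) ≤ d := by exact_mod_cast hd
  have habs : ∀ x ∈ ν.support, 1 ≤ |laplacian ξ x| := fun x hx =>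
    one_le_abs_of_int (hint x) (by rw [← hν]; exact Finsupp.mem_support_iff.1 hx)
  by_cases hcard : 3 ≤ ν.support.card
  · obtain ⟨F, hF, hF3⟩ := Finset.exists_subset_card_eq hcard
    obtain ⟨B, -, hB⟩ := sum_abs_laplacian_sq_le (by omega) ξ F
    refine ⟨B, ?_⟩
    have h1 : (3 : ℝ) ≤ ∑ x ∈ F, |laplacian ξ x| := by
      have := Finset.card_nsmul_le_sum F (fun x => |laplacian ξ x|) 1 fun x hx => habs x (hF hx)
      rw [hF3] at this; simpa using this
    rw [hF3] at hB
    have h2 : (0 : ℝ) ≤ ∑ z ∈ B, ξ z ^ 2 := Finset.sum_nonneg fun _ _ => sq_nonneg _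
    have h3 : (9 : ℝ) ≤ (12 * d ^ 2 + 30 * d) * ∑ z ∈ B, ξ z ^ 2 := by
      push_cast at hB; nlinarith
    have h4 : (12 * d ^ 2 + 30 * d : ℝ) ≤ 9 * (2 * (d : ℝ) ^ 2 - d + 100) := by
      nlinarith [sq_nonneg ((d : ℝ) - 4)]
    nlinarith [mul_le_mul_of_nonneg_right h4 h2]
  by_cases htwo : ∃ x, 2 ≤ |laplacian ξ x|
  · obtain ⟨x, hx⟩ := htwo
    obtain ⟨B, -, hB⟩ := sum_abs_laplacian_sq_le (by omega) ξ {x}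
    refine ⟨B, ?_⟩
    have h2 : (0 : ℝ) ≤ ∑ z ∈ B, ξ z ^ 2 := Finset.sum_nonneg fun _ _ => sq_nonneg _
    simp only [Finset.sum_singleton, Finset.card_singleton] at hB
    have h3 : (4 : ℝ) ≤ (4 * d ^ 2 + 2 * d) * ∑ z ∈ B, ξ z ^ 2 := by
      push_cast at hB; nlinarith
    have h4 : (4 * d ^ 2 + 2 * d : ℝ) ≤ 4 * (2 * (d : ℝ) ^ 2 - d + 100) := by
      nlinarith [sq_nonneg ((d : ℝ) - 4)]
    nlinarith [mul_le_mul_of_nonneg_right h4 h2]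
  push Not at htwo hcard
  have hval : ∀ x ∈ ν.support, ν x = 1 ∨ ν x = -1 := by
    intro x hx
    obtain ⟨n, hn⟩ := hint x
    have h1 := habs x hx
    have h2 := htwo x
    rw [hν, hn]
    rw [hn] at h1 h2
    norm_cast at h1 h2 ⊢
    grind
  -- two points with opposite unit charges
  have hpair : ∃ x y, x ≠ y ∧ ν = Finsupp.single x 1 - Finsupp.single y 1 := by
    have hpos : 0 < ν.support.card := Finset.card_pos.2 (Finsupp.support_nonempty_iff.2 h0)
    have hc : ν.support.card = 1 ∨ ν.support.card = 2 := by omega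
    rcases hc with hc | hc
    · obtain ⟨x, hx⟩ := Finset.card_eq_one.1 hc
      rw [hx, Finset.sum_singleton] at hsum
      have := Finsupp.mem_support_iff.1 (hx ▸ Finset.mem_singleton_self x : x ∈ ν.support)
      exact absurd hsum this
    · obtain ⟨x, y, hxy, hs⟩ := Finset.card_eq_two.1 hc
      rw [hs, Finset.sum_pair hxy] at hsum
      have hout : ∀ z, z ≠ x → z ≠ y → ν z = 0 := fun z h1 h2 => by
        rw [← Finsupp.notMem_support_iff, hs]; simp [h1, h2]
      rcases hval x (by simp [hs]) with hx | hx
      · refine ⟨x, y, hxy, Finsupp.ext fun z => ?_⟩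
        by_cases h1 : z = x
        · subst h1; simp [hx, Ne.symm hxy]
        · by_cases h2 : z = y
          · subst h2; simp [hxy]; linarith
          · simp [hout z h1 h2, Ne.symm h1, Ne.symm h2]
      · refine ⟨y, x, hxy.symm, Finsupp.ext fun z => ?_⟩
        by_cases h1 : z = x
        · subst h1; simp [hx, Ne.symm hxy]
        · by_cases h2 : z = y
          · subst h2; simp [hxy]; linarith
          · simp [hout z h1 h2, Ne.symm h1, Ne.symm h2]
  obtain ⟨x, y, hxy, rfl⟩ := hpair
  obtain ⟨B, hB⟩ := dipole_sq_le (by omega) hxy hν.symm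
  refine ⟨B, ?_⟩
  have h2 : (0 : ℝ) ≤ ∑ z ∈ B, ξ z ^ 2 := Finset.sum_nonneg fun _ _ => sq_nonneg _
  rcases walks_one_eq (x - y) with h1 | h1 <;> rw [h1] at hB
  · norm_num at hB
    nlinarith
  · have h3 : (8 * d ^ 2 - 12 * d - 8 * d * 1 + 60 : ℝ) ≤
        (2 * (d : ℝ) ^ 2 - d + 100) * (2 - 2 * 1 / d) ^ 2 := by
      rw [show (2 - 2 * 1 / d : ℝ) = (2 * d - 2) / d by field_simp, div_pow, mul_div_assoc',
        le_div_iff₀ (by positivity)]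
      nlinarith [mul_nonneg (sq_nonneg (d : ℝ)) (by linarith : (0 : ℝ) ≤ d - 3)]
    have h4 : (0 : ℝ) < (2 - 2 * 1 / d) ^ 2 := by
      have : (2 : ℝ) * 1 / d ≤ 1 := by rw [div_le_one (by positivity)]; linarith
      exact pow_pos (by linarith) 2
    have h5 := hB.trans (mul_le_mul_of_nonneg_right h3 h2)
    by_contra! hlt
    nlinarith [mul_lt_mul_of_pos_left hlt h4]

/-- Lower bound for the spectral parameter with periodic boundary. -/
theorem ofReal_le_gammaPeriodic (hd : 3 ≤ d) {A L : ℝ} (hA : A < 1) (hLA : L ≤ A)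
    (hL : L * (2 * (d : ℝ) ^ 2 - d + 100) ≤ 2 * Real.pi ^ 2 * (1 - A / (19 / 4))) :
    ENNReal.ofReal L ≤ gammaPeriodic d := by
  refine le_iInf₂ fun ξ hξ => ?_
  obtain ⟨hmem, hC, hne⟩ := hξ
  have hd' : (3 : ℝ) ≤ d := by exact_mod_cast hd
  set η : Lattice d → ℝ := fun x => centered (ξ x) with hη
  obtain ⟨ν, hν, hsum⟩ := exists_finsupp_laplacian_centered hmem hC
  have hint : ∀ x, ∃ n : ℤ, laplacian ξ x = n := fun x => by
    obtain ⟨μ, hμ, -⟩ := hC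
    exact ⟨μ x, hμ x⟩
  have h0 : ν ≠ 0 := by
    rintro rfl
    have h1 := eq_zero_of_laplacian_eq_zero (by omega) (memℓp_centered hmem)
      fun x => by rw [← hν]; rfl
    refine hne fun x => ?_
    obtain ⟨n, hn⟩ := exists_eq_centered_add (ξ x)
    have h2 : centered (ξ x) = 0 := congrFun h1 x
    exact ⟨n, by rw [hn, h2, zero_add]⟩
  obtain ⟨B, hB⟩ := exists_finset_one_le_of_sum_eq_zero hd (laplacian_centered_int hint) hν hsum h0
  have h := ofReal_le_tsum_energy (Q := Set.univ) (fun x => abs_centered_le_half (ξ x))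
    (fun z _ => Set.mem_univ z) (by nlinarith) hB hA hLA hL
  rw [tsum_univ fun x => energy (centered (ξ x))] at h
  simpa only [energy_centered] using h

/-! ### Fourier analysis on the torus -/

open MeasureTheory UnitAddTorus
open scoped ComplexConjugate

/-- The normalized Haar measure on the torus `(ℝ/ℤ)^d`. -/
noncomputable abbrev torusMeasure (d : ℕ) : Measure (UnitAddTorus (Fin d)) :=
  Measure.pi fun _ => AddCircle.haarAddCircle

/-- The characteristic function `X(θ) = d⁻¹ ∑ᵢ cos (2π θᵢ)` of a step of simple random walk. -/
noncomputable def stepChar (d : ℕ) (θ : UnitAddTorus (Fin d)) : ℝ :=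
  (∑ i, (fourier 1 (θ i) : ℂ).re) / d

/-- The Fourier transform `1 / (2d (1 - X))` of the Green function. -/
noncomputable def greenChar (d : ℕ) (θ : UnitAddTorus (Fin d)) : ℝ :=
  (2 * d * (1 - stepChar d θ))⁻¹

/-- The Fourier coefficients of a function on the torus. -/
noncomputable def coef (f : UnitAddTorus (Fin d) → ℂ) (n : Lattice d) : ℂ :=
  ∫ θ, mFourier (-n) θ * f θ ∂torusMeasure d

theorem parseval {f : UnitAddTorus (Fin d) → ℂ} (hf : MemLp f 2 (torusMeasure d)) :
    HasSum (fun n => ‖coef f n‖ ^ 2) (∫ θ, ‖f θ‖ ^ 2 ∂torusMeasure d) := by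
  have h := hasSum_sq_mFourierCoeff (d := Fin d) (hf.toLp f)
  have h1 : ∀ n, mFourierCoeff (hf.toLp f) n = coef f n := fun n => by
    refine integral_congr_ae ?_
    filter_upwards [hf.coeFn_toLp] with θ hθ
    rw [hθ]; rfl
  have h2 : ∫ θ, ‖hf.toLp f θ‖ ^ 2 ∂torusMeasure d = ∫ θ, ‖f θ‖ ^ 2 ∂torusMeasure d := by
    refine integral_congr_ae ?_
    filter_upwards [hf.coeFn_toLp] with θ hθ
    rw [hθ]
  simp_rw [h1] at h
  rw [← h2]
  exact h

theorem norm_mFourier_apply (n : Lattice d) (θ : UnitAddTorus (Fin d)) : ‖mFourier n θ‖ = 1 := by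
  simp only [mFourier, ContinuousMap.coe_mk, fourier_apply, norm_prod, Circle.norm_coe,
    Finset.prod_const_one]

theorem integrable_mFourier_mul {f : UnitAddTorus (Fin d) → ℂ} (hf : Integrable f (torusMeasure d))
    (n : Lattice d) : Integrable (fun θ => mFourier n θ * f θ) (torusMeasure d) :=
  hf.bdd_mul (mFourier n).continuous.aestronglyMeasurable
    (ae_of_all _ fun θ => (norm_mFourier_apply n θ).le)

theorem coef_mFourier_mul (f : UnitAddTorus (Fin d) → ℂ) (m n : Lattice d) :
    coef (fun θ => mFourier m θ * f θ) n = coef f (n - m) := by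
  unfold coef
  congr 1
  funext θ
  rw [← mul_assoc, ← mFourier_add]
  congr 3; abel

theorem fourier_re_le_one (t : UnitAddCircle) : (fourier 1 t : ℂ).re ≤ 1 := by
  refine (Complex.re_le_norm _).trans ?_
  rw [fourier_apply]
  exact (Circle.norm_coe _).le

theorem neg_one_le_fourier_re (t : UnitAddCircle) : -1 ≤ (fourier 1 t : ℂ).re := by
  have := Complex.abs_re_le_norm (fourier 1 t : ℂ)
  simp only [fourier_apply, Circle.norm_coe] at this
  exact (abs_le.1 this).1

theorem continuous_fourier_re : Continuous fun t : UnitAddCircle => (fourier 1 t : ℂ).re :=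
  Complex.continuous_re.comp (fourier 1).continuous

theorem continuous_stepChar : Continuous (stepChar d) := by
  unfold stepChar
  refine Continuous.div_const (continuous_finsetSum _ fun i _ => ?_) _
  exact continuous_fourier_re.comp (continuous_apply i)

theorem measurable_greenChar : Measurable (greenChar d) :=
  (measurable_const.mul (measurable_const.sub continuous_stepChar.measurable)).inv

theorem sum_mFourier_single (θ : UnitAddTorus (Fin d)) (hd : 1 ≤ d) :
    ∑ i : Fin d, (mFourier (Pi.single i 1) θ + mFourier (-Pi.single i 1) θ) =
      ((2 * d * stepChar d θ : ℝ) : ℂ) := by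
  have hd' : (d : ℝ) ≠ 0 := by exact_mod_cast (by omega : d ≠ 0)
  have h : (2 * d * stepChar d θ : ℝ) = ∑ i, 2 * (fourier 1 (θ i) : ℂ).re := by
    rw [stepChar, ← Finset.mul_sum]; field_simp
  rw [h, Complex.ofReal_sum]
  refine Finset.sum_congr rfl fun i _ => ?_
  rw [mFourier_neg, mFourier_single, Complex.add_conj]

theorem haarAddCircle_eq_volume :
    (AddCircle.haarAddCircle : Measure UnitAddCircle) = (volume : Measure (AddCircle (1 : ℝ))) := by
  rw [AddCircle.volume_eq_smul_haarAddCircle]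
  simp

/-- A point with `X(θ) = 1` has all coordinates zero, so such points form a null set. -/
theorem stepChar_ne_one (hd : 1 ≤ d) : ∀ᵐ θ ∂torusMeasure d, stepChar d θ ≠ 1 := by
  have hd' : (0 : ℝ) < d := by exact_mod_cast hd
  set i : Fin d := ⟨0, hd⟩
  have h0 : ∀ᵐ t ∂(AddCircle.haarAddCircle : Measure UnitAddCircle), t ≠ 0 := by
    rw [ae_iff]; simp only [ne_eq, not_not]
    rw [haarAddCircle_eq_volume]
    change volume {x : AddCircle (1 : ℝ) | x = 0} = 0
    have h := AddCircle.volume_closedBall (T := (1 : ℝ)) (x := 0) 0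
    rw [Metric.closedBall_zero] at h
    simpa using h
  have h1 := (measurePreserving_eval (fun _ : Fin d =>
    (AddCircle.haarAddCircle : Measure UnitAddCircle)) i).quasiMeasurePreserving.ae h0
  filter_upwards [h1] with θ hθ hX
  apply hθ
  rw [stepChar, div_eq_one_iff_eq hd'.ne'] at hX
  have h2 : ∑ k, (1 - (fourier 1 (θ k) : ℂ).re) = 0 := by
    rw [Finset.sum_sub_distrib, hX]; simp
  have h3 := (Finset.sum_eq_zero_iff_of_nonneg fun k _ => by
    linarith [fourier_re_le_one (θ k)]).1 h2 i (Finset.mem_univ _)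
  have h4 : ((AddCircle.toCircle (θ i) : Circle) : ℂ) = 1 := by
    have h5 : (fourier 1 (θ i) : ℂ).re = 1 := by linarith
    rw [fourier_one] at h5
    have h6 := Complex.sq_norm_sub_sq_re ((AddCircle.toCircle (θ i) : Circle) : ℂ)
    rw [Circle.norm_coe, h5] at h6
    apply Complex.ext
    · simpa using h5
    · have : ((AddCircle.toCircle (θ i) : Circle) : ℂ).im ^ 2 = 0 := by linarith
      simpa using this
  apply AddCircle.injective_toCircle one_ne_zero
  rw [AddCircle.toCircle_zero]
  exact Circle.ext h4

/-- Changing the sign of the coordinates in `s`. -/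
def flip (s : Finset (Fin d)) (θ : UnitAddTorus (Fin d)) : UnitAddTorus (Fin d) :=
  fun k => if k ∈ s then -θ k else θ k

theorem integral_flip {E : Type*} [NormedAddCommGroup E] [NormedSpace ℝ E] (s : Finset (Fin d))
    (f : UnitAddTorus (Fin d) → E) :
    ∫ θ, f (flip s θ) ∂torusMeasure d = ∫ θ, f θ ∂torusMeasure d := by
  have h : MeasurePreserving (flip s) (torusMeasure d) (torusMeasure d) := by
    have := measurePreserving_pi
      (fun _ : Fin d => (AddCircle.haarAddCircle : Measure UnitAddCircle))
      (fun _ => AddCircle.haarAddCircle) (f := fun k t => if k ∈ s then -t else t) fun k => by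
        by_cases hk : k ∈ s
        · simpa [hk] using Measure.measurePreserving_neg _
        · simp only [hk, if_false]; exact MeasurePreserving.id _
    exact this
  have hinv : Function.Involutive (flip s) := fun θ => by
    funext k; by_cases hk : k ∈ s <;> simp [flip, hk]
  have hme : MeasurableEmbedding (flip s) :=
    (MeasurableEquiv.mk hinv.toPerm h.measurable h.measurable).measurableEmbedding
  exact h.integral_comp hme f

theorem flip_univ (θ : UnitAddTorus (Fin d)) : flip Finset.univ θ = -θ := by
  funext k; simp [flip]

theorem mFourier_neg_right (n : Lattice d) (θ : UnitAddTorus (Fin d)) :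
    mFourier n (-θ) = conj (mFourier n θ) := by
  rw [← mFourier_neg]
  simp [mFourier, fourier_apply]

theorem mFourier_reflection (i : Fin d) (n : Lattice d) (θ : UnitAddTorus (Fin d)) :
    mFourier (reflection i n) θ = mFourier n (flip {i} θ) := by
  simp only [mFourier, ContinuousMap.coe_mk]
  refine Finset.prod_congr rfl fun k _ => ?_
  by_cases hk : k = i
  · subst hk; simp [reflection_apply, flip, fourier_apply]
  · simp [reflection_apply, flip, hk]

theorem fourier_neg_re (t : UnitAddCircle) : (fourier 1 (-t) : ℂ).re = (fourier 1 t : ℂ).re := by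
  have : (fourier 1 (-t) : ℂ) = conj (fourier 1 t : ℂ) := by
    rw [← fourier_neg]; simp [fourier_apply]
  rw [this, Complex.conj_re]

theorem stepChar_flip (s : Finset (Fin d)) (θ : UnitAddTorus (Fin d)) :
    stepChar d (flip s θ) = stepChar d θ := by
  unfold stepChar flip
  congr 1
  refine Finset.sum_congr rfl fun k _ => ?_
  split_ifs
  · exact fourier_neg_re _
  · rfl

theorem greenChar_flip (s : Finset (Fin d)) (θ : UnitAddTorus (Fin d)) :
    greenChar d (flip s θ) = greenChar d θ := by
  simp only [greenChar, stepChar_flip]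

/-- Functions with Hermitian symmetry have real Fourier coefficients. -/
theorem coef_conj {f : UnitAddTorus (Fin d) → ℂ} (hf : ∀ θ, f (-θ) = conj (f θ)) (n : Lattice d) :
    conj (coef f n) = coef f n := by
  unfold coef
  rw [← integral_conj, ← integral_flip Finset.univ fun θ => mFourier (-n) θ * f θ]
  congr 1
  funext θ
  rw [flip_univ, hf, mFourier_neg_right, map_mul]

/-- The solution of `Δξ = ν` in `ℓ²(ℤ^d)` when `ν` is integral with Fourier transform `P`: its
Fourier transform is `P` times that of the Green function. -/
theorem exists_solution (hd : 1 ≤ d) (hG : MemLp (greenChar d) 2 (torusMeasure d))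
    (P : C(UnitAddTorus (Fin d), ℂ)) (hP : ∀ θ, P (-θ) = conj (P θ)) :
    ∃ ξ : Lattice d → ℝ, (∀ n, (ξ n : ℂ) = coef (fun θ => greenChar d θ * P θ) n) ∧
      (∀ n, (laplacian ξ n : ℂ) = coef P n) ∧
      HasSum (fun n => ξ n ^ 2) (∫ θ, greenChar d θ ^ 2 * ‖P θ‖ ^ 2 ∂torusMeasure d) := by
  set f : UnitAddTorus (Fin d) → ℂ := fun θ => greenChar d θ * P θ with hf
  have hd' : (d : ℝ) ≠ 0 := by exact_mod_cast (by omega : d ≠ 0)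
  have hreal : ∀ n, (((coef f n).re : ℝ) : ℂ) = coef f n := fun n => by
    refine Complex.conj_eq_iff_re.1 (coef_conj (fun θ => ?_) n)
    simp only [hf]
    rw [← flip_univ, greenChar_flip, flip_univ, hP, map_mul, Complex.conj_ofReal]
  have hmem : MemLp f 2 (torusMeasure d) := by
    have h1 : MemLp (fun θ => (greenChar d θ : ℂ)) 2 (torusMeasure d) := hG.ofReal
    have h2 : MemLp (fun θ => P θ) ∞ (torusMeasure d) :=
      memLp_top_of_bound P.continuous.aestronglyMeasurable ‖P‖
        (ae_of_all _ fun θ => P.norm_coe_le_norm θ)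
    exact h2.mul' h1
  have hint : Integrable f (torusMeasure d) := hmem.integrable (by norm_num)
  refine ⟨fun n => (coef f n).re, hreal, fun n => ?_, ?_⟩
  · have h1 : ∀ m, coef f (n - m) = ∫ θ, mFourier (-n) θ * (mFourier m θ * f θ) ∂torusMeasure d :=
      fun m => (coef_mFourier_mul f m n).symm
    have hi : ∀ m, Integrable (fun θ => mFourier (-n) θ * (mFourier m θ * f θ)) (torusMeasure d) :=
      fun m => integrable_mFourier_mul (integrable_mFourier_mul hint m) _
    have hsum : ∀ i : Fin d, coef f (n + Pi.single i 1) + coef f (n - Pi.single i 1) =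
        ∫ θ, (mFourier (-n) θ * (mFourier (-Pi.single i 1) θ * f θ) +
          mFourier (-n) θ * (mFourier (Pi.single i 1) θ * f θ)) ∂torusMeasure d := fun i => by
      rw [integral_add (hi _) (hi _), ← h1, ← h1, sub_neg_eq_add]
    simp only [laplacian]
    push_cast
    simp only [hreal, hsum]
    have hi' : ∀ i : Fin d, Integrable (fun θ => mFourier (-n) θ * (mFourier (-Pi.single i 1) θ *
        f θ) + mFourier (-n) θ * (mFourier (Pi.single i 1) θ * f θ)) (torusMeasure d) :=
      fun i => (hi _).add (hi _)
    rw [← integral_finsetSum _ fun i _ => hi' i, coef, ← integral_const_mul,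
      ← integral_sub ((integrable_mFourier_mul hint _).const_mul _)
        (integrable_finsetSum _ fun i _ => hi' i)]
    refine integral_congr_ae ?_
    filter_upwards [stepChar_ne_one hd] with θ hθ
    have h2 : ∑ i : Fin d, (mFourier (-n) θ * (mFourier (-Pi.single i 1) θ * f θ) +
          mFourier (-n) θ * (mFourier (Pi.single i 1) θ * f θ)) =
        mFourier (-n) θ * f θ * ((2 * d * stepChar d θ : ℝ) : ℂ) := by
      rw [← sum_mFourier_single θ hd, Finset.mul_sum]
      exact Finset.sum_congr rfl fun i _ => by ring
    have h3 : 2 * d * (1 - stepChar d θ) * greenChar d θ = 1 :=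
      mul_inv_cancel₀ (mul_ne_zero (by positivity) (sub_ne_zero.2 hθ.symm))
    have h4 : ((2 * d * (1 - stepChar d θ) * greenChar d θ : ℝ) : ℂ) = 1 := by rw [h3]; simp
    rw [h2]
    simp only [hf]
    push_cast at h4 ⊢
    linear_combination (mFourier (-n) θ * P θ) * h4
  · have h := parseval hmem
    have h1 : ∀ n, ‖coef f n‖ ^ 2 = (coef f n).re ^ 2 := fun n => by
      rw [← hreal n, Complex.norm_real, Complex.ofReal_re, Real.norm_eq_abs, sq_abs]
    simp_rw [h1] at h
    convert h using 3 with θ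
    rw [hf, norm_mul, Complex.norm_real, Real.norm_eq_abs, mul_pow, sq_abs]

/-! ### Negative moments of `1 - X` -/

theorem fourier_one_coe_re (x : ℝ) :
    (fourier 1 (x : UnitAddCircle) : ℂ).re = Real.cos (2 * Real.pi * x) := by
  rw [fourier_coe_apply]
  have : (2 * Real.pi * Complex.I * (1 : ℤ) * x / (1 : ℝ) : ℂ) =
      ((2 * Real.pi * x : ℝ) : ℂ) * Complex.I := by push_cast; ring
  rw [this, Complex.exp_ofReal_mul_I_re]

theorem eight_mul_sq_le_one_sub_cos {t : ℝ} (ht : |t| ≤ 1 / 2) :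
    8 * t ^ 2 ≤ 1 - Real.cos (2 * Real.pi * t) := by
  have hpi := Real.pi_pos
  have h := Real.cos_le_one_sub_mul_cos_sq (x := 2 * Real.pi * t) (by
    rw [abs_mul, abs_of_pos (by positivity : 0 < 2 * Real.pi)]; nlinarith)
  have h2 : 2 / Real.pi ^ 2 * (2 * Real.pi * t) ^ 2 = 8 * t ^ 2 := by field_simp; ring
  linarith

/-- The function `(1 - cos (2πt))^(-1/4)` on the circle has an integrable singularity. -/
theorem integrable_one_sub_rpow :
    Integrable (fun t : UnitAddCircle => (1 - (fourier 1 t : ℂ).re) ^ (-(1 / 4) : ℝ))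
      AddCircle.haarAddCircle := by
  rw [haarAddCircle_eq_volume]
  have hmeas : Measurable fun t : UnitAddCircle => (1 - (fourier 1 t : ℂ).re) ^ (-(1 / 4) : ℝ) :=
    (measurable_const.sub continuous_fourier_re.measurable).pow_const _
  rw [← (UnitAddCircle.measurePreserving_mk 0).integrable_comp hmeas.aestronglyMeasurable, zero_add]
  have h1 : IntervalIntegrable (fun x : ℝ => x ^ (-(1 / 2) : ℝ)) volume 0 1 :=
    intervalIntegral.intervalIntegrable_rpow' (by norm_num)
  have h2 : IntervalIntegrable (fun x : ℝ => (1 - x) ^ (-(1 / 2) : ℝ)) volume 0 1 := by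
    simpa using (h1.comp_sub_left 1).symm
  have h3 := (h1.add h2).1
  refine Integrable.mono' h3 (hmeas.comp AddCircle.measurable_mk').aestronglyMeasurable ?_
  refine (ae_restrict_iff' measurableSet_Ioc).2 (ae_of_all _ fun x hx => ?_)
  have key : ∀ y : ℝ, 0 < y → y ≤ 1 / 2 →
      (1 - Real.cos (2 * Real.pi * y)) ^ (-(1 / 4) : ℝ) ≤ y ^ (-(1 / 2) : ℝ) := by
    intro y hy hy2
    have h4 := eight_mul_sq_le_one_sub_cos (t := y) (by rw [abs_of_pos hy]; exact hy2)
    calc (1 - Real.cos (2 * Real.pi * y)) ^ (-(1 / 4) : ℝ) ≤ (y ^ 2) ^ (-(1 / 4) : ℝ) :=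
          Real.rpow_le_rpow_of_nonpos (by positivity) (by nlinarith [sq_nonneg y]) (by norm_num)
      _ = y ^ (-(1 / 2) : ℝ) := by
          rw [← Real.rpow_natCast, ← Real.rpow_mul hy.le]; norm_num
  have hx1 : 0 ≤ x ^ (-(1 / 2) : ℝ) := Real.rpow_nonneg hx.1.le _
  have hx2 : 0 ≤ (1 - x) ^ (-(1 / 2) : ℝ) := Real.rpow_nonneg (by linarith [hx.2]) _
  change ‖(1 - (fourier 1 (x : UnitAddCircle) : ℂ).re) ^ (-(1 / 4) : ℝ)‖ ≤ _
  rw [fourier_one_coe_re, Real.norm_of_nonneg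
    (Real.rpow_nonneg (by linarith [Real.cos_le_one (2 * Real.pi * x)]) _)]
  rcases le_or_gt x (1 / 2) with h | h
  · linarith [key x hx.1 h]
  · rcases hx.2.eq_or_lt with rfl | hx3
    · norm_num [Real.zero_rpow]
    · have h5 := key (1 - x) (by linarith) (by linarith)
      rw [show 2 * Real.pi * (1 - x) = 2 * Real.pi - 2 * Real.pi * x by ring,
        Real.cos_two_pi_sub] at h5
      linarith

theorem fourier_re_lt_one :
    ∀ᵐ θ ∂torusMeasure d, ∀ i, (fourier 1 (θ i) : ℂ).re < 1 := by
  rw [ae_all_iff]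
  intro i
  have h0 : ∀ᵐ t ∂(AddCircle.haarAddCircle : Measure UnitAddCircle), (fourier 1 t : ℂ).re < 1 := by
    have h1 := stepChar_ne_one (d := 1) le_rfl
    have h2 := (measurePreserving_piUnique (fun _ : Fin 1 =>
      (AddCircle.haarAddCircle : Measure UnitAddCircle))).symm.quasiMeasurePreserving.ae h1
    filter_upwards [h2] with t ht
    refine lt_of_le_of_ne (fourier_re_le_one t) ?_
    simpa [stepChar] using ht
  exact (measurePreserving_eval (fun _ : Fin d =>
    (AddCircle.haarAddCircle : Measure UnitAddCircle)) i).quasiMeasurePreserving.ae h0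

theorem one_sub_stepChar (hd : 1 ≤ d) (θ : UnitAddTorus (Fin d)) :
    1 - stepChar d θ = ∑ i, (d : ℝ)⁻¹ * (1 - (fourier 1 (θ i) : ℂ).re) := by
  have hd' : (d : ℝ) ≠ 0 := by exact_mod_cast (by omega : d ≠ 0)
  rw [← Finset.mul_sum, Finset.sum_sub_distrib, stepChar]
  simp
  field_simp

/-- By the inequality of arithmetic and geometric means, negative powers of `1 - X` are dominated
by products over the coordinates. -/
theorem inv_pow_four_le_prod (hd : 16 ≤ d) : ∀ᵐ θ ∂torusMeasure d,
    ((1 - stepChar d θ) ^ 4)⁻¹ ≤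
      ∏ i, (1 + 16 / d * ((1 - (fourier 1 (θ i) : ℂ).re) ^ (-(1 / 4) : ℝ) - 1)) := by
  have hd' : (16 : ℝ) ≤ d := by exact_mod_cast hd
  filter_upwards [fourier_re_lt_one (d := d)] with θ hθ
  set y : Fin d → ℝ := fun i => 1 - (fourier 1 (θ i) : ℂ).re with hy
  have hpos : ∀ i, 0 < y i := fun i => sub_pos.2 (hθ i)
  have h1 : ∏ i, y i ^ (d : ℝ)⁻¹ ≤ 1 - stepChar d θ := by
    rw [one_sub_stepChar (by omega)]
    refine Real.geom_mean_le_arith_mean_weighted _ _ _ (fun _ _ => by positivity) ?_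
      fun i _ => (hpos i).le
    simp; field_simp
  have h2 : 0 < ∏ i, y i ^ (d : ℝ)⁻¹ := Finset.prod_pos fun i _ => Real.rpow_pos_of_pos (hpos i) _
  refine (inv_anti₀ (by positivity) (pow_le_pow_left₀ h2.le h1 4)).trans ?_
  rw [← Finset.prod_pow, ← Finset.prod_inv_distrib]
  refine Finset.prod_le_prod (fun i _ => by have := hpos i; positivity) fun i _ => ?_
  have h3 : ((y i ^ (d : ℝ)⁻¹) ^ 4)⁻¹ = (1 + (y i ^ (-(1 / 4) : ℝ) - 1)) ^ (16 / d : ℝ) := by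
    rw [add_sub_cancel, ← Real.rpow_natCast, ← Real.rpow_mul (hpos i).le,
      ← Real.rpow_neg (hpos i).le, ← Real.rpow_mul (hpos i).le]
    congr 1; push_cast; field_simp; norm_num
  rw [h3]
  -- Bernoulli's inequality, with an exponent `16 / d` at most `1`
  exact rpow_one_add_le_one_add_mul_self (by linarith [Real.rpow_nonneg (hpos i).le (-(1 / 4))])
    (by positivity) (by rw [div_le_one (by linarith)]; exact hd')

/-- The negative fourth moment of `1 - X` is bounded uniformly in the dimension. -/
theorem exists_integral_inv_pow_four_le : ∃ C : ℝ, ∀ d : ℕ, 16 ≤ d →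
    Integrable (fun θ => ((1 - stepChar d θ) ^ 4)⁻¹) (torusMeasure d) ∧
      ∫ θ, ((1 - stepChar d θ) ^ 4)⁻¹ ∂torusMeasure d ≤ C := by
  set a : UnitAddCircle → ℝ := fun t => (1 - (fourier 1 t : ℂ).re) ^ (-(1 / 4) : ℝ) with ha
  set K := ∫ t, a t ∂AddCircle.haarAddCircle
  refine ⟨Real.exp (16 * (K - 1)), fun d hd => ?_⟩
  have hd' : (16 : ℝ) ≤ d := by exact_mod_cast hd
  set b : UnitAddCircle → ℝ := fun t => 1 + 16 / d * (a t - 1) with hb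
  have hai : Integrable a AddCircle.haarAddCircle := integrable_one_sub_rpow
  have hsub : Integrable (fun t => a t - 1) AddCircle.haarAddCircle :=
    hai.sub (integrable_const _)
  have hbi : Integrable b AddCircle.haarAddCircle := (integrable_const _).add (hsub.const_mul _)
  have hbK : ∫ t, b t ∂AddCircle.haarAddCircle = 1 + 16 / d * (K - 1) := by
    rw [integral_add (integrable_const _) (hsub.const_mul _), integral_const_mul,
      integral_sub hai (integrable_const _)]
    simp [K]
  have hb0 : 0 ≤ ∫ t, b t ∂AddCircle.haarAddCircle := integral_nonneg fun t => by
    have h1 : (16 : ℝ) / d ≤ 1 := by rw [div_le_one (by linarith)]; exact hd'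
    have h2 : 0 ≤ a t := Real.rpow_nonneg (by linarith [fourier_re_le_one t]) _
    have h3 : 0 ≤ (16 : ℝ) / d * a t := by positivity
    simp only [hb, Pi.zero_apply]; linarith
  have hprod : Integrable (fun θ : UnitAddTorus (Fin d) => ∏ i, b (θ i)) (torusMeasure d) :=
    Integrable.fintype_prod fun _ => hbi
  have hle := inv_pow_four_le_prod hd
  have hint : Integrable (fun θ => ((1 - stepChar d θ) ^ 4)⁻¹) (torusMeasure d) := by
    refine hprod.mono' ?_ ?_
    · exact ((continuous_const.sub continuous_stepChar).pow 4).measurable.inv.aestronglyMeasurable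
    · filter_upwards [hle] with θ hθ
      rwa [Real.norm_of_nonneg (by positivity)]
  refine ⟨hint, (integral_mono_ae hint hprod hle).trans ?_⟩
  rw [integral_fintype_prod_eq_prod (𝕜 := ℝ) fun _ => b]
  rw [Finset.prod_const, Finset.card_univ, Fintype.card_fin, hbK]
  rw [hbK] at hb0
  calc (1 + 16 / d * (K - 1)) ^ d ≤ Real.exp (16 / d * (K - 1)) ^ d :=
        pow_le_pow_left₀ hb0 (by linarith [Real.add_one_le_exp (16 / d * (K - 1))]) _
    _ = Real.exp (16 * (K - 1)) := by
        rw [← Real.exp_nat_mul]; congr 1; field_simp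

theorem integrable_of_continuous {E : Type*} [NormedAddCommGroup E]
    {f : UnitAddTorus (Fin d) → E} (hf : Continuous f) : Integrable f (torusMeasure d) :=
  hf.integrable_of_hasCompactSupport (HasCompactSupport.of_compactSpace f)

theorem integrable_circle_of_continuous {f : UnitAddCircle → ℝ} (hf : Continuous f) :
    Integrable f AddCircle.haarAddCircle :=
  hf.integrable_of_hasCompactSupport (HasCompactSupport.of_compactSpace f)

theorem fourier_add_half (t : UnitAddCircle) :
    (fourier 1 (t + ((1 / 2 : ℝ) : UnitAddCircle)) : ℂ) = -fourier 1 t := by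
  have := fourier_add_half_inv_index (T := 1) (n := 1) one_ne_zero one_pos t
  simpa using this

theorem fourier_add_quarter (t : UnitAddCircle) :
    (fourier 1 (t + ((1 / 4 : ℝ) : UnitAddCircle)) : ℂ) = Complex.I * fourier 1 t := by
  rw [fourier_one, AddCircle.toCircle_add, Circle.coe_mul, mul_comm, ← fourier_one, ← fourier_one,
    fourier_coe_apply]
  congr 1
  rw [show (2 * Real.pi * Complex.I * (1 : ℤ) * ((1 / 4 : ℝ) : ℂ) / (1 : ℝ) : ℂ) =
    Real.pi / 2 * Complex.I by push_cast; ring, Complex.exp_pi_div_two_mul_I]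

theorem integral_fourier_re :
    ∫ t : UnitAddCircle, (fourier 1 t : ℂ).re ∂AddCircle.haarAddCircle = 0 := by
  have h := integral_add_right_eq_self (μ := (AddCircle.haarAddCircle : Measure UnitAddCircle))
    (fun t => (fourier 1 t : ℂ).re) ((1 / 2 : ℝ) : UnitAddCircle)
  simp only [fourier_add_half, Complex.neg_re, integral_neg] at h
  linarith

/-- A quarter turn exchanges `cos²` and `sin²`, which therefore both have mean `1 / 2`. -/
theorem integral_fourier_re_sq :
    ∫ t : UnitAddCircle, (fourier 1 t : ℂ).re ^ 2 ∂AddCircle.haarAddCircle = 1 / 2 := by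
  have h := integral_add_right_eq_self (μ := (AddCircle.haarAddCircle : Measure UnitAddCircle))
    (fun t => (fourier 1 t : ℂ).re ^ 2) ((1 / 4 : ℝ) : UnitAddCircle)
  have h1 : ∀ t : UnitAddCircle, (fourier 1 (t + ((1 / 4 : ℝ) : UnitAddCircle)) : ℂ).re ^ 2 =
      1 - (fourier 1 t : ℂ).re ^ 2 := fun t => by
    rw [fourier_add_quarter, Complex.I_mul_re, neg_sq]
    have := Complex.sq_norm_sub_sq_re (fourier 1 t : ℂ)
    rw [fourier_apply, Circle.norm_coe, ← fourier_apply] at this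
    linarith
  simp only [h1] at h
  have h2 : Integrable (fun t : UnitAddCircle => (fourier 1 t : ℂ).re ^ 2)
      AddCircle.haarAddCircle := integrable_circle_of_continuous (continuous_fourier_re.pow 2)
  rw [integral_sub (integrable_const _) h2, integral_const, probReal_univ, one_smul] at h
  linarith

/-- The half turn of all coordinates changes the sign of `X`, so the odd moments vanish. -/
theorem integral_stepChar_odd {k : ℕ} (hk : Odd k) :
    ∫ θ, stepChar d θ ^ k ∂torusMeasure d = 0 := by
  have h := integral_add_right_eq_self (μ := torusMeasure d) (fun θ => stepChar d θ ^ k)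
    (fun _ => ((1 / 2 : ℝ) : UnitAddCircle))
  have h1 : ∀ θ : UnitAddTorus (Fin d),
      stepChar d (θ + fun _ => ((1 / 2 : ℝ) : UnitAddCircle)) = -stepChar d θ := fun θ => by
    simp only [stepChar, Pi.add_apply, fourier_add_half, Complex.neg_re, Finset.sum_neg_distrib,
      neg_div]
  simp only [h1, hk.neg_pow, integral_neg] at h
  linarith

theorem integral_stepChar_sq (hd : 1 ≤ d) :
    ∫ θ, stepChar d θ ^ 2 ∂torusMeasure d = 1 / (2 * d) := by
  have hd' : (d : ℝ) ≠ 0 := by exact_mod_cast (by omega : d ≠ 0)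
  have hc : ∀ i : Fin d, Continuous fun θ : UnitAddTorus (Fin d) => (fourier 1 (θ i) : ℂ).re :=
    fun i => continuous_fourier_re.comp (continuous_apply i)
  have h1 : ∀ i k : Fin d, ∫ θ, (fourier 1 (θ i) : ℂ).re * (fourier 1 (θ k) : ℂ).re
      ∂torusMeasure d = if i = k then 1 / 2 else 0 := by
    intro i k
    split_ifs with h
    · subst h
      have h := integral_comp_eval (μ := fun _ : Fin d =>
        (AddCircle.haarAddCircle : Measure UnitAddCircle)) (i := i)
        (f := fun t => (fourier 1 t : ℂ).re ^ 2) (continuous_fourier_re.pow 2).aestronglyMeasurable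
      rw [← integral_fourier_re_sq, ← h]
      simp only [sq]
    · have h := integral_add_right_eq_self (μ := torusMeasure d)
        (fun θ => (fourier 1 (θ i) : ℂ).re * (fourier 1 (θ k) : ℂ).re)
        (Pi.single i ((1 / 2 : ℝ) : UnitAddCircle))
      simp only [Pi.add_apply, Pi.single_eq_same, Pi.single_eq_of_ne (Ne.symm ‹i ≠ k›), add_zero,
        fourier_add_half, Complex.neg_re, neg_mul, integral_neg] at h
      linarith
  have h2 : ∀ θ : UnitAddTorus (Fin d), stepChar d θ ^ 2 =
      ((d : ℝ) ^ 2)⁻¹ * ∑ i, ∑ k, (fourier 1 (θ i) : ℂ).re * (fourier 1 (θ k) : ℂ).re := fun θ => by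
    rw [← Finset.sum_mul_sum, stepChar]; field_simp
  simp_rw [h2]
  have hi : ∀ i k : Fin d, Integrable (fun θ : UnitAddTorus (Fin d) =>
      (fourier 1 (θ i) : ℂ).re * (fourier 1 (θ k) : ℂ).re) (torusMeasure d) :=
    fun i k => integrable_of_continuous ((hc i).mul (hc k))
  rw [integral_const_mul, integral_finsetSum _ fun i _ => integrable_finsetSum _ fun k _ => hi i k]
  simp_rw [integral_finsetSum _ fun k _ => hi _ k, h1]
  simp
  field_simp

/-- Exponential moments: `X` has sub-Gaussian fluctuations of order `d^(-1/2)`. -/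
theorem integral_exp_le (s : ℝ) (hs : |s| ≤ 1) :
    ∫ θ, Real.exp (s * ∑ i, (fourier 1 (θ i) : ℂ).re) ∂torusMeasure d ≤ Real.exp (d * s ^ 2) := by
  have h1 : ∀ θ : UnitAddTorus (Fin d), Real.exp (s * ∑ i, (fourier 1 (θ i) : ℂ).re) =
      ∏ i, Real.exp (s * (fourier 1 (θ i) : ℂ).re) := fun θ => by
    rw [Finset.mul_sum, Real.exp_sum]
  simp_rw [h1]
  rw [integral_fintype_prod_eq_prod (𝕜 := ℝ)
    fun _ t => Real.exp (s * (fourier 1 t : ℂ).re)]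
  rw [Finset.prod_const, Finset.card_univ, Fintype.card_fin, Real.exp_nat_mul]
  refine pow_le_pow_left₀ (integral_nonneg fun t => (Real.exp_pos _).le) ?_ d
  have hc := continuous_fourier_re
  have h2 : ∀ t : UnitAddCircle, Real.exp (s * (fourier 1 t : ℂ).re) ≤
      1 + s * (fourier 1 t : ℂ).re + s ^ 2 := fun t => by
    have h3 : |(fourier 1 t : ℂ).re| ≤ 1 := abs_le.2 ⟨neg_one_le_fourier_re t, fourier_re_le_one t⟩
    have h4 : |s * (fourier 1 t : ℂ).re| ≤ 1 := by
      rw [abs_mul]; exact mul_le_one₀ hs (abs_nonneg _) h3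
    have h5 := (abs_le.1 (Real.abs_exp_sub_one_sub_id_le h4)).2
    have h6 : (fourier 1 t : ℂ).re ^ 2 ≤ 1 := by rw [← sq_abs]; exact pow_le_one₀ (abs_nonneg _) h3
    nlinarith [sq_nonneg s]
  refine (integral_mono (integrable_circle_of_continuous (by fun_prop))
    (integrable_circle_of_continuous (by fun_prop)) h2).trans ?_
  rw [integral_add (integrable_circle_of_continuous (by fun_prop)) (integrable_const _),
    integral_add (integrable_const _) (integrable_circle_of_continuous (by fun_prop)),
    integral_const_mul, integral_fourier_re]
  simp
  linarith [Real.add_one_le_exp (s ^ 2)]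

/-- The eighth moment of `X` has order `d⁻⁴`, by the exponential moments at `s = d^(-1/2)`. -/
theorem integral_stepChar_pow_eight_le (hd : 1 ≤ d) :
    ∫ θ, stepChar d θ ^ 8 ∂torusMeasure d ≤ 2 * (Nat.factorial 8) * Real.exp 1 / d ^ 4 := by
  have hd' : (1 : ℝ) ≤ d := by exact_mod_cast hd
  set s : ℝ := (√d)⁻¹ with hs
  have hs2 : s ^ 2 = (d : ℝ)⁻¹ := by rw [hs, inv_pow, Real.sq_sqrt (by linarith)]
  have hs0 : 0 ≤ s := by positivity
  have hs1 : |s| ≤ 1 := by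
    rw [abs_of_nonneg hs0]; nlinarith [inv_le_one_of_one_le₀ hd']
  have hpow : ∀ y : ℝ, y ^ 8 ≤ Nat.factorial 8 * (Real.exp y + Real.exp (-y)) := by
    intro y
    have h1 := Real.pow_div_factorial_le_exp _ (abs_nonneg y) 8
    rw [div_le_iff₀ (by positivity), ← abs_pow, abs_of_nonneg (by positivity)] at h1
    refine h1.trans ?_
    rw [mul_comm]
    gcongr
    rcases abs_choice y with h | h <;> rw [h] <;> linarith [Real.exp_pos y, Real.exp_pos (-y)]
  have hc : Continuous fun θ : UnitAddTorus (Fin d) => ∑ i, (fourier 1 (θ i) : ℂ).re :=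
    continuous_finsetSum _ fun i _ => continuous_fourier_re.comp (continuous_apply i)
  have hle : ∀ θ : UnitAddTorus (Fin d), stepChar d θ ^ 8 ≤ Nat.factorial 8 / d ^ 4 *
      (Real.exp (s * ∑ i, (fourier 1 (θ i) : ℂ).re) +
        Real.exp (-s * ∑ i, (fourier 1 (θ i) : ℂ).re)) := fun θ => by
    have h1 := hpow (s * ∑ i, (fourier 1 (θ i) : ℂ).re)
    have h2 : (s * ∑ i, (fourier 1 (θ i) : ℂ).re) ^ 8 = d ^ 4 * stepChar d θ ^ 8 := by
      rw [stepChar, mul_pow, show s ^ 8 = (s ^ 2) ^ 4 by ring, hs2]; field_simp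
    rw [h2] at h1
    rw [div_mul_eq_mul_div, le_div_iff₀ (by positivity), neg_mul]
    linarith
  refine (integral_mono (integrable_of_continuous (continuous_stepChar.pow 8))
    (integrable_of_continuous (by fun_prop)) hle).trans ?_
  rw [integral_const_mul, integral_add (integrable_of_continuous (by fun_prop))
    (integrable_of_continuous (by fun_prop))]
  have h1 := integral_exp_le (d := d) s hs1
  have h2 := integral_exp_le (d := d) (-s) (by rwa [abs_neg])
  rw [neg_sq] at h2
  rw [hs2, mul_inv_cancel₀ (by linarith)] at h1 h2
  rw [div_mul_eq_mul_div]
  refine div_le_div_of_nonneg_right ?_ (by positivity)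
  nlinarith [(by positivity : (0 : ℝ) < Nat.factorial 8)]

theorem abs_stepChar_le (hd : 1 ≤ d) (θ : UnitAddTorus (Fin d)) : |stepChar d θ| ≤ 1 := by
  have hd' : (0 : ℝ) < d := by exact_mod_cast hd
  rw [stepChar, abs_div, abs_of_pos hd', div_le_one hd']
  refine (Finset.abs_sum_le_sum_abs _ _).trans ((Finset.sum_le_card_nsmul _ _ 1 fun i _ =>
    abs_le.2 ⟨neg_one_le_fourier_re _, fourier_re_le_one _⟩).trans_eq ?_)
  simp

theorem measurable_inv_one_sub_pow (k : ℕ) :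
    Measurable fun θ => ((1 - stepChar d θ) ^ k)⁻¹ :=
  ((continuous_const.sub continuous_stepChar).pow k).measurable.inv

/-- The remainder term in the expansion of `(1 - X)⁻²` has order `d⁻²`. -/
theorem exists_integral_remainder_le : ∃ C : ℝ, ∀ d : ℕ, 16 ≤ d →
    Integrable (fun θ => stepChar d θ ^ 4 * ((1 - stepChar d θ) ^ 2)⁻¹) (torusMeasure d) ∧
      ∫ θ, stepChar d θ ^ 4 * ((1 - stepChar d θ) ^ 2)⁻¹ ∂torusMeasure d ≤ C / d ^ 2 := by
  obtain ⟨C, hC⟩ := exists_integral_inv_pow_four_le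
  refine ⟨(2 * (Nat.factorial 8) * Real.exp 1 + C) / 2, fun d hd => ?_⟩
  have hd' : (16 : ℝ) ≤ d := by exact_mod_cast hd
  obtain ⟨hi, hle⟩ := hC d hd
  have h8 := integral_stepChar_pow_eight_le (d := d) (by omega)
  have hi8 : Integrable (fun θ => stepChar d θ ^ 8) (torusMeasure d) :=
    integrable_of_continuous (continuous_stepChar.pow 8)
  have hdom : ∀ θ : UnitAddTorus (Fin d), stepChar d θ ^ 4 * ((1 - stepChar d θ) ^ 2)⁻¹ ≤
      d ^ 2 / 2 * stepChar d θ ^ 8 + 1 / (2 * d ^ 2) * ((1 - stepChar d θ) ^ 4)⁻¹ := fun θ => by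
    have h1 : ((1 - stepChar d θ) ^ 4)⁻¹ = (((1 - stepChar d θ) ^ 2)⁻¹) ^ 2 := by
      rw [inv_pow, ← pow_mul]
    rw [h1]
    generalize ((1 - stepChar d θ) ^ 2)⁻¹ = w
    -- the inequality `2ab ≤ a² + b²`, weighted so that both moments contribute order `d⁻²`
    have h2 : 0 ≤ (d * stepChar d θ ^ 4 - w / d) ^ 2 := sq_nonneg _
    have h3 : (d * stepChar d θ ^ 4 - w / d) ^ 2 = 2 * (d ^ 2 / 2 * stepChar d θ ^ 8 +
      1 / (2 * d ^ 2) * w ^ 2 - stepChar d θ ^ 4 * w) := by field_simp; ring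
    linarith
  have hdi := (hi8.const_mul ((d : ℝ) ^ 2 / 2)).add (hi.const_mul (1 / (2 * (d : ℝ) ^ 2)))
  have hint : Integrable (fun θ => stepChar d θ ^ 4 * ((1 - stepChar d θ) ^ 2)⁻¹)
      (torusMeasure d) := by
    refine hdi.mono' ((continuous_stepChar.pow 4).measurable.mul
      (measurable_inv_one_sub_pow 2)).aestronglyMeasurable (ae_of_all _ fun θ => ?_)
    rw [Real.norm_of_nonneg (by positivity)]
    exact hdom θ
  refine ⟨hint, (integral_mono hint hdi hdom).trans ?_⟩
  simp only [Pi.add_apply]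
  rw [integral_add (hi8.const_mul _) (hi.const_mul _), integral_const_mul, integral_const_mul]
  have h1 : d ^ 2 / 2 * ∫ θ, stepChar d θ ^ 8 ∂torusMeasure d ≤
      d ^ 2 / 2 * (2 * (Nat.factorial 8) * Real.exp 1 / d ^ 4) := by gcongr
  have h2 : 1 / (2 * (d : ℝ) ^ 2) * ∫ θ, ((1 - stepChar d θ) ^ 4)⁻¹ ∂torusMeasure d ≤
      1 / (2 * d ^ 2) * C := by gcongr
  refine (add_le_add h1 h2).trans_eq ?_
  field_simp

/-- Expansion of the second and first negative moments of `1 - X` up to order `d⁻²`. -/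
theorem exists_integral_inv_le : ∃ C : ℝ, ∀ d : ℕ, 16 ≤ d →
    (Integrable (fun θ => ((1 - stepChar d θ) ^ 2)⁻¹) (torusMeasure d) ∧
      ∫ θ, ((1 - stepChar d θ) ^ 2)⁻¹ ∂torusMeasure d ≤ 1 + 3 / (2 * d) + C / d ^ 2) ∧
    (Integrable (fun θ => (1 - stepChar d θ)⁻¹) (torusMeasure d) ∧
      ∫ θ, (1 - stepChar d θ)⁻¹ ∂torusMeasure d ≤ 1 + 1 / (2 * d) + C / d ^ 2) := by
  obtain ⟨C, hC⟩ := exists_integral_remainder_le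
  refine ⟨9 * C, fun d hd => ?_⟩
  have hd1 : 1 ≤ d := by omega
  obtain ⟨hi, hle⟩ := hC d hd
  set r : UnitAddTorus (Fin d) → ℝ := fun θ => stepChar d θ ^ 4 * ((1 - stepChar d θ) ^ 2)⁻¹
  have hr : ∀ θ, 0 ≤ r θ := fun θ => by positivity
  have hcont := continuous_stepChar (d := d)
  have hdom2 : ∀ᵐ θ ∂torusMeasure d, ((1 - stepChar d θ) ^ 2)⁻¹ ≤
      (1 + 2 * stepChar d θ ^ 1 + 3 * stepChar d θ ^ 2 + 4 * stepChar d θ ^ 3) + 9 * r θ := by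
    filter_upwards [stepChar_ne_one hd1] with θ hθ
    have h1 := sub_ne_zero.2 hθ.symm
    have h2 := (abs_le.1 (abs_stepChar_le hd1 θ)).1
    have h3 : ((1 - stepChar d θ) ^ 2)⁻¹ = (1 + 2 * stepChar d θ ^ 1 + 3 * stepChar d θ ^ 2 +
      4 * stepChar d θ ^ 3) + (5 - 4 * stepChar d θ) * r θ := by
      simp only [r]; field_simp; ring
    rw [h3]
    have := mul_le_mul_of_nonneg_right (by linarith : 5 - 4 * stepChar d θ ≤ 9) (hr θ)
    linarith
  have hdom1 : ∀ᵐ θ ∂torusMeasure d, (1 - stepChar d θ)⁻¹ ≤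
      (1 + 1 * stepChar d θ ^ 1 + 1 * stepChar d θ ^ 2 + 1 * stepChar d θ ^ 3) + 9 * r θ := by
    filter_upwards [stepChar_ne_one hd1] with θ hθ
    have h1 := sub_ne_zero.2 hθ.symm
    have h2 := (abs_le.1 (abs_stepChar_le hd1 θ)).1
    have h3 : (1 - stepChar d θ)⁻¹ = (1 + 1 * stepChar d θ ^ 1 + 1 * stepChar d θ ^ 2 +
      1 * stepChar d θ ^ 3) + (1 - stepChar d θ) * r θ := by
      simp only [r]; field_simp; ring
    rw [h3]
    have := mul_le_mul_of_nonneg_right (by linarith : 1 - stepChar d θ ≤ 9) (hr θ)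
    linarith
  have hpoly : ∀ a b c : ℝ, Integrable (fun θ => (1 + a * stepChar d θ ^ 1 + b * stepChar d θ ^ 2 +
      c * stepChar d θ ^ 3) + 9 * r θ) (torusMeasure d) := fun a b c =>
    (integrable_of_continuous (by fun_prop)).add (hi.const_mul _)
  have hval : ∀ a b c : ℝ, ∫ θ, ((1 + a * stepChar d θ ^ 1 + b * stepChar d θ ^ 2 +
      c * stepChar d θ ^ 3) + 9 * r θ) ∂torusMeasure d ≤ 1 + b * (1 / (2 * d)) + 9 * C / d ^ 2 := by
    intro a b c
    rw [integral_add (integrable_of_continuous (by fun_prop)) (hi.const_mul _),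
      integral_add (integrable_of_continuous (by fun_prop))
        (integrable_of_continuous (by fun_prop)),
      integral_add (integrable_of_continuous (by fun_prop))
        (integrable_of_continuous (by fun_prop)),
      integral_add (integrable_const _) (integrable_of_continuous (by fun_prop)),
      integral_const_mul, integral_const_mul, integral_const_mul, integral_const_mul,
      integral_stepChar_odd (k := 1) (by decide), integral_stepChar_odd (k := 3) (by decide),
      integral_stepChar_sq hd1]
    simp
    have : 9 * ∫ θ, r θ ∂torusMeasure d ≤ 9 * (C / d ^ 2) := by gcongr
    rw [mul_div_assoc]
    linarith
  refine ⟨⟨?_, ?_⟩, ⟨?_, ?_⟩⟩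
  · refine (hpoly 2 3 4).mono' (measurable_inv_one_sub_pow 2).aestronglyMeasurable ?_
    filter_upwards [hdom2] with θ hθ
    rwa [Real.norm_of_nonneg (by positivity)]
  · refine (integral_mono_of_nonneg (ae_of_all _ fun θ => by positivity) (hpoly 2 3 4)
      hdom2).trans ((hval 2 3 4).trans_eq (by ring))
  · refine (hpoly 1 1 1).mono' (measurable_const.sub hcont.measurable).inv.aestronglyMeasurable ?_
    filter_upwards [hdom1] with θ hθ
    rwa [Real.norm_of_nonneg (inv_nonneg.2 (by linarith [(abs_le.1 (abs_stepChar_le hd1 θ)).2]))]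
  · refine (integral_mono_of_nonneg (ae_of_all _ fun θ => inv_nonneg.2 (by
      linarith [(abs_le.1 (abs_stepChar_le hd1 θ)).2])) (hpoly 1 1 1)
      hdom1).trans ((hval 1 1 1).trans_eq (by ring))

/-! ### The Green function and the upper bound for periodic boundary -/

theorem coef_one (n : Lattice d) : coef (fun _ => 1) n = if n = 0 then 1 else 0 := by
  have h1 : ∀ k : ℤ, ∫ t, fourier k t ∂(AddCircle.haarAddCircle : Measure UnitAddCircle) =
      if k = 0 then (1 : ℂ) else 0 := fun k => by
    have h := congrFun (fourierCoeff_fourier (T := (1 : ℝ)) 0) (-k)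
    simpa [fourierCoeff, Pi.single_apply] using h
  simp only [coef, mul_one, mFourier, ContinuousMap.coe_mk]
  rw [integral_fintype_prod_eq_prod (𝕜 := ℂ) fun i t => fourier ((-n) i) t]
  simp only [h1, Finset.prod_ite_zero, Finset.prod_const_one]
  refine if_congr ?_ rfl rfl
  simp [funext_iff]

theorem coef_mFourier (m n : Lattice d) : coef (mFourier m) n = if n = m then 1 else 0 := by
  have h := coef_mFourier_mul (fun _ => 1) m n
  simp only [mul_one] at h
  rw [h, coef_one]
  simp only [sub_eq_zero]

theorem coef_sub {f g : UnitAddTorus (Fin d) → ℂ} (hf : Integrable f (torusMeasure d))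
    (hg : Integrable g (torusMeasure d)) (n : Lattice d) :
    coef (fun θ => f θ - g θ) n = coef f n - coef g n := by
  simp only [coef, mul_sub]
  exact integral_sub (integrable_mFourier_mul hf _) (integrable_mFourier_mul hg _)

theorem integrable_inv_pow_two (hd : 16 ≤ d) :
    Integrable (fun θ => ((1 - stepChar d θ) ^ 2)⁻¹) (torusMeasure d) := by
  obtain ⟨C, hC⟩ := exists_integral_inv_le
  exact (hC d hd).1.1

theorem greenChar_sq (θ : UnitAddTorus (Fin d)) :
    greenChar d θ ^ 2 = (4 * (d : ℝ) ^ 2)⁻¹ * ((1 - stepChar d θ) ^ 2)⁻¹ := by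
  rw [greenChar, ← mul_inv, inv_pow]
  congr 1
  ring

theorem memLp_greenChar (hd : 16 ≤ d) : MemLp (greenChar d) 2 (torusMeasure d) := by
  rw [memLp_two_iff_integrable_sq measurable_greenChar.aestronglyMeasurable]
  simp only [greenChar_sq]
  exact (integrable_inv_pow_two hd).const_mul _

theorem memLp_greenChar_sq (hd : 16 ≤ d) :
    MemLp (fun θ => greenChar d θ ^ 2) 2 (torusMeasure d) := by
  rw [memLp_two_iff_integrable_sq (measurable_greenChar.pow_const 2).aestronglyMeasurable]
  obtain ⟨C, hC⟩ := exists_integral_inv_pow_four_le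
  have h : ∀ θ, (greenChar d θ ^ 2) ^ 2 = ((4 * (d : ℝ) ^ 2)⁻¹) ^ 2 *
      ((1 - stepChar d θ) ^ 4)⁻¹ := fun θ => by
    rw [greenChar_sq, mul_pow, inv_pow ((1 - stepChar d θ) ^ 2), ← pow_mul]
  simp only [h]
  exact (hC d hd).1.const_mul _

/-- The square norm of the Green function, on the Fourier side. -/
noncomputable def greenEnergy (d : ℕ) : ℝ := ∫ θ, greenChar d θ ^ 2 ∂torusMeasure d

theorem greenEnergy_eq (d : ℕ) : greenEnergy d =
    (4 * (d : ℝ) ^ 2)⁻¹ * ∫ θ, ((1 - stepChar d θ) ^ 2)⁻¹ ∂torusMeasure d := by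
  simp only [greenEnergy, greenChar_sq, integral_const_mul]

theorem greenEnergy_pos (hd : 16 ≤ d) : 0 < greenEnergy d := by
  have hd1 : 1 ≤ d := by omega
  have hd' : (0 : ℝ) < d := by exact_mod_cast hd1
  have h : (1 : ℝ) / 4 ≤ ∫ θ, ((1 - stepChar d θ) ^ 2)⁻¹ ∂torusMeasure d := by
    have h1 : ∫ _θ : UnitAddTorus (Fin d), (1 / 4 : ℝ) ∂torusMeasure d = 1 / 4 := by simp
    rw [← h1]
    refine integral_mono_ae (integrable_const _) (integrable_inv_pow_two hd) ?_
    filter_upwards [stepChar_ne_one hd1] with θ hθ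
    have h2 := abs_le.1 (abs_stepChar_le hd1 θ)
    have h3 : 0 < (1 - stepChar d θ) ^ 2 := by
      have := sub_ne_zero.2 hθ.symm; positivity
    rw [one_div]
    exact inv_anti₀ h3 (by nlinarith)
  rw [greenEnergy_eq]
  have : (0 : ℝ) < ∫ θ, ((1 - stepChar d θ) ^ 2)⁻¹ ∂torusMeasure d := by linarith
  positivity

theorem energy_le (t : ℝ) : energy t ≤ ENNReal.ofReal (2 * Real.pi ^ 2 * t ^ 2) := by
  refine ENNReal.ofReal_le_ofReal ?_
  have := Real.one_sub_sq_div_two_le_cos (x := 2 * Real.pi * t)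
  linarith

theorem tsum_ofReal_sq {ξ : Lattice d → ℝ} {I : ℝ} (h : HasSum (fun n => ξ n ^ 2) I) :
    ∑' n, ENNReal.ofReal (2 * Real.pi ^ 2 * ξ n ^ 2) = ENNReal.ofReal (2 * Real.pi ^ 2 * I) := by
  have h1 := h.mul_left (2 * Real.pi ^ 2)
  rw [← h1.tsum_eq, ENNReal.ofReal_tsum_of_nonneg (fun n => by positivity) h1.summable]

/-- An integer valued function of square norm less than `1` vanishes. -/
theorem eq_zero_of_int_of_hasSum {ξ : Lattice d → ℝ} {I : ℝ} (h : HasSum (fun n => ξ n ^ 2) I)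
    (hI : I < 1) (hint : ∀ x, ∃ n : ℤ, ξ x = n) (x : Lattice d) : ξ x = 0 := by
  by_contra h0
  have h1 := one_le_abs_of_int (hint x) h0
  have h2 := le_hasSum h x fun y _ => sq_nonneg _
  rw [← sq_abs] at h2
  nlinarith

/-- Upper bound for the spectral parameter with periodic boundary: among the dipoles
`δ_0 - δ_{e_i}`, one has at most the average square norm. -/
theorem gammaPeriodic_le (hd : 16 ≤ d)
    (hsmall : (2 * (d : ℝ) ^ 2)⁻¹ * ∫ θ, (1 - stepChar d θ)⁻¹ ∂torusMeasure d < 1) :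
    gammaPeriodic d ≤ ENNReal.ofReal (2 * Real.pi ^ 2 *
      ((2 * (d : ℝ) ^ 2)⁻¹ * ∫ θ, (1 - stepChar d θ)⁻¹ ∂torusMeasure d)) := by
  have hd1 : 1 ≤ d := by omega
  have hd' : (0 : ℝ) < d := by exact_mod_cast hd1
  set J := ∫ θ, (1 - stepChar d θ)⁻¹ ∂torusMeasure d with hJ
  set P : Fin d → C(UnitAddTorus (Fin d), ℂ) := fun i => mFourier 0 - mFourier (Pi.single i 1)
    with hP
  have hPn : ∀ i θ, ‖P i θ‖ ^ 2 = 2 - 2 * (fourier 1 (θ i) : ℂ).re := fun i θ => by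
    have h1 : P i θ = 1 - fourier 1 (θ i) := by
      simp only [hP, ContinuousMap.sub_apply, mFourier_zero, ContinuousMap.one_apply,
        mFourier_single]
    have h2 := Complex.sq_norm_sub_sq_re (fourier 1 (θ i) : ℂ)
    rw [fourier_apply, Circle.norm_coe, ← fourier_apply] at h2
    rw [h1, ← Complex.normSq_eq_norm_sq, Complex.normSq_apply]
    simp only [Complex.sub_re, Complex.one_re, Complex.sub_im, Complex.one_im]
    linarith
  have hint : ∀ i, Integrable (fun θ => greenChar d θ ^ 2 * ‖P i θ‖ ^ 2) (torusMeasure d) := by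
    intro i
    have h1 : Integrable (fun θ => greenChar d θ ^ 2) (torusMeasure d) :=
      (memLp_greenChar hd).integrable_sq
    refine (h1.bdd_mul (f := fun θ => ‖P i θ‖ ^ 2) (c := 4) ?_ (ae_of_all _ fun θ => ?_)).congr
      (ae_of_all _ fun θ => mul_comm _ _)
    · exact ((P i).continuous.norm.pow 2).aestronglyMeasurable
    · rw [Real.norm_of_nonneg (by positivity), hPn]
      linarith [neg_one_le_fourier_re (θ i)]
  have hsum : ∑ i, ∫ θ, greenChar d θ ^ 2 * ‖P i θ‖ ^ 2 ∂torusMeasure d = (2 * d : ℝ)⁻¹ * J := by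
    rw [← integral_finsetSum _ fun i _ => hint i, hJ, ← integral_const_mul]
    refine integral_congr_ae ?_
    filter_upwards [stepChar_ne_one hd1] with θ hθ
    have h1 := sub_ne_zero.2 hθ.symm
    have h2 : ∑ i, ‖P i θ‖ ^ 2 = 2 * d * (1 - stepChar d θ) := by
      rw [one_sub_stepChar hd1, ← Finset.mul_sum]
      simp only [hPn, Finset.sum_sub_distrib, ← Finset.mul_sum]
      simp
      field_simp
    rw [← Finset.mul_sum, h2, greenChar_sq]
    field_simp
    ring
  obtain ⟨i, -, hi⟩ := Finset.exists_le_of_sum_le (s := Finset.univ)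
    (f := fun i => ∫ θ, greenChar d θ ^ 2 * ‖P i θ‖ ^ 2 ∂torusMeasure d)
    (g := fun _ => (2 * (d : ℝ) ^ 2)⁻¹ * J) ⟨⟨0, hd1⟩, Finset.mem_univ _⟩ (by
      rw [hsum, Finset.sum_const, Finset.card_univ, Fintype.card_fin, nsmul_eq_mul]
      refine le_of_eq ?_; field_simp)
  obtain ⟨ξ, -, hlap, hξ⟩ := exists_solution hd1 (memLp_greenChar hd) (P i) fun θ => by
    simp only [hP, ContinuousMap.sub_apply, mFourier_neg_right, map_sub]
  have hlap' : ∀ n, laplacian ξ n =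
      ((Finsupp.single 0 1 - Finsupp.single (Pi.single i 1) 1 : Lattice d →₀ ℤ) n : ℤ) := by
    intro n
    have h1 : coef (P i) n = coef (mFourier 0) n - coef (mFourier (Pi.single i 1)) n :=
      coef_sub (integrable_of_continuous (mFourier 0).continuous)
        (integrable_of_continuous (mFourier _).continuous) n
    have h2 := hlap n
    rw [h1, coef_mFourier, coef_mFourier] at h2
    have h3 : (laplacian ξ n : ℂ) = ((((Finsupp.single 0 1 - Finsupp.single (Pi.single i 1) 1 :
        Lattice d →₀ ℤ) n : ℤ) : ℝ) : ℂ) := by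
      rw [h2]
      simp only [Finsupp.sub_apply, Finsupp.single_apply, eq_comm (a := n)]
      split_ifs <;> simp
    exact_mod_cast h3
  have hC1 : IsC1 (laplacian ξ) := by
    refine ⟨_, hlap', ?_⟩
    rw [Finsupp.sum_sub_index (by intros; rfl)]
    simp
  -- the square norm is less than `1`, so `ξ` is not integer valued
  have hne : NonzeroModOne ξ := by
    intro hi'
    have h1 := eq_zero_of_int_of_hasSum hξ (hi.trans_lt hsmall) hi'
    have h2 : ξ = 0 := funext h1
    have h3 := hlap' 0
    rw [h2, laplacian_zero] at h3
    have h4 : (Pi.single i 1 : Lattice d) ≠ 0 := by simp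
    simp [h4] at h3
  refine (iInf₂_le ξ ⟨memℓp_two_iff.2 hξ.summable, hC1, hne⟩).trans ?_
  refine (ENNReal.tsum_le_tsum fun n => energy_le (ξ n)).trans ?_
  rw [tsum_ofReal_sq hξ]
  exact ENNReal.ofReal_le_ofReal (by gcongr)

/-! ### Reflected charges and the upper bound for open boundary -/

/-- Sums over the fundamental domain: a nonnegative function which is invariant under the
reflections and vanishes on the hyperplanes has `2^|S|` equal parts. -/
theorem two_pow_mul_tsum_le (S : Finset (Fin d)) (G : Lattice d → ℝ≥0∞)
    (hG : ∀ i ∈ S, ∀ x, G (reflection i x) = G x)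
    (h0 : ∀ i ∈ S, ∀ x : Lattice d, x i = 0 → G x = 0) :
    2 ^ S.card * ∑' x : quotientDomain S, G x ≤ ∑' x, G x := by
  induction S using Finset.induction_on with
  | empty =>
    rw [tsum_subtype (quotientDomain ∅) G]
    simp [quotientDomain]
  | insert i T hi ih =>
    classical
    have ih' := ih (fun k hk => hG k (Finset.mem_insert_of_mem hk))
      fun k hk => h0 k (Finset.mem_insert_of_mem hk)
    refine le_trans ?_ ih'
    rw [Finset.card_insert_of_notMem hi, pow_succ, mul_assoc]
    gcongr
    rw [tsum_subtype (quotientDomain _) G, tsum_subtype (quotientDomain T) G, two_mul]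
    nth_rewrite 2 [← Equiv.tsum_eq (reflection i)]
    rw [← ENNReal.tsum_add]
    refine ENNReal.tsum_le_tsum fun x => ?_
    simp only [Set.indicator_apply, hG i (Finset.mem_insert_self _ _)]
    have hx : ∀ y : Lattice d, y ∈ quotientDomain (insert i T) ↔
        0 ≤ y i ∧ y ∈ quotientDomain T := fun y => by simp [quotientDomain]
    have hr : reflection i x ∈ quotientDomain T ↔ x ∈ quotientDomain T := by
      refine forall₂_congr fun k hk => ?_
      have : k ≠ i := fun h => hi (h ▸ hk)
      simp [reflection_apply, this]
    have hri : reflection i x i = -x i := by simp [reflection_apply]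
    rw [hx, hx, hr, hri]
    rcases lt_trichotomy (x i) 0 with h | h | h
    · by_cases hT : x ∈ quotientDomain T
      · simp [hT, not_le.2 h, h.le]
      · simp [hT]
    · simp [h0 i (Finset.mem_insert_self _ _) x h]
    · by_cases hT : x ∈ quotientDomain T
      · simp [hT, h.le, not_le.2 h]
      · simp [hT]

/-- The multiplier `1 - cos (4π m θᵢ)`: half of the square modulus of the Fourier transform
`e^(2πi m θᵢ) - e^(-2πi m θᵢ)` of a charge at distance `m` from the hyperplane `x i = 0` and its
mirror image. -/
noncomputable def foldFactor (m : ℕ) (i : Fin d) (θ : UnitAddTorus (Fin d)) : ℝ :=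
  1 - (mFourier (Pi.single i (2 * m : ℤ)) θ).re

theorem continuous_foldFactor (m : ℕ) (i : Fin d) :
    Continuous (foldFactor (d := d) m i) :=
  continuous_const.sub (Complex.continuous_re.comp (mFourier _).continuous)

theorem foldFactor_mem (m : ℕ) (i : Fin d) (θ : UnitAddTorus (Fin d)) :
    0 ≤ foldFactor m i θ ∧ foldFactor m i θ ≤ 2 := by
  have h := Complex.abs_re_le_norm (mFourier (Pi.single i (2 * m : ℤ)) θ)
  rw [norm_mFourier_apply, abs_le] at h
  unfold foldFactor
  constructor <;> linarith

theorem memLp_mul_prod_foldFactor {F : UnitAddTorus (Fin d) → ℝ}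
    (hF : MemLp F 2 (torusMeasure d)) (T : Finset (Fin d)) (m : Fin d → ℕ) :
    MemLp (fun θ => F θ * ∏ i ∈ T, foldFactor (m i) i θ) 2 (torusMeasure d) := by
  have h : MemLp (fun θ => ∏ i ∈ T, foldFactor (d := d) (m i) i θ) ∞ (torusMeasure d) := by
    refine memLp_top_of_bound (continuous_finsetProd _ fun i _ =>
      continuous_foldFactor (m i) i).aestronglyMeasurable (2 ^ T.card) (ae_of_all _ fun θ => ?_)
    rw [Real.norm_of_nonneg (Finset.prod_nonneg fun i _ => (foldFactor_mem _ _ _).1)]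
    exact (Finset.prod_le_prod (fun i _ => (foldFactor_mem _ _ _).1)
      fun i _ => (foldFactor_mem _ _ _).2).trans_eq (by simp)
  exact h.mul' hF

/-- The Riemann–Lebesgue lemma: a charge far away from the hyperplane and its mirror image do not
interact. -/
theorem exists_abs_integral_foldFactor_lt {F : UnitAddTorus (Fin d) → ℝ}
    (hF : MemLp F 2 (torusMeasure d)) (i : Fin d) {ε : ℝ} (hε : 0 < ε) :
    ∃ m : ℕ, |∫ θ, F θ * foldFactor m i θ ∂torusMeasure d - ∫ θ, F θ ∂torusMeasure d| < ε := by
  have hFc : MemLp (fun θ => (F θ : ℂ)) 2 (torusMeasure d) := hF.ofReal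
  have hFi : Integrable (fun θ => (F θ : ℂ)) (torusMeasure d) := hFc.integrable (by norm_num)
  have h1 := (parseval hFc).summable.tendsto_cofinite_zero
  have hinj : Function.Injective fun m : ℕ => -(Pi.single i (2 * m : ℤ) : Lattice d) := by
    intro a b h
    have := congrFun h i
    simpa using this
  have h2 := h1.comp hinj.tendsto_cofinite
  have h3 := h2.eventually (gt_mem_nhds (by positivity : 0 < ε ^ 2))
  rw [Nat.cofinite_eq_atTop] at h3
  obtain ⟨m, hm⟩ := h3.exists
  refine ⟨m, ?_⟩
  simp only [Function.comp_apply] at hm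
  set z := coef (fun θ => (F θ : ℂ)) (-(Pi.single i (2 * m : ℤ) : Lattice d)) with hz
  have hre : z.re = ∫ θ, F θ * (mFourier (Pi.single i (2 * m : ℤ)) θ).re ∂torusMeasure d := by
    rw [hz, coef, neg_neg]
    have h4 := integral_re (𝕜 := ℂ) (integrable_mFourier_mul hFi (Pi.single i (2 * m : ℤ)))
    refine Eq.trans h4.symm ?_
    congr 1
    funext θ
    simp [mul_comm]
  have hFr : Integrable F (torusMeasure d) := hF.integrable (by norm_num)
  have hmi : Integrable (fun θ => F θ * (mFourier (Pi.single i (2 * m : ℤ)) θ).re)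
      (torusMeasure d) := by
    have := (integrable_mFourier_mul hFi (Pi.single i (2 * m : ℤ))).re
    refine this.congr (ae_of_all _ fun θ => ?_)
    simp [mul_comm]
  have h5 : ∫ θ, F θ * foldFactor m i θ ∂torusMeasure d = ∫ θ, F θ ∂torusMeasure d - z.re := by
    rw [hre, ← integral_sub hFr hmi]
    congr 1
    funext θ
    rw [foldFactor]; ring
  rw [h5, sub_sub_cancel_left, abs_neg]
  exact (Complex.abs_re_le_norm z).trans_lt (lt_of_pow_lt_pow_left₀ 2 hε.le hm)

theorem exists_abs_integral_prod_foldFactor_lt {F : UnitAddTorus (Fin d) → ℝ}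
    (hF : MemLp F 2 (torusMeasure d)) (T : Finset (Fin d)) {ε : ℝ} (hε : 0 < ε) :
    ∃ m : Fin d → ℕ, |∫ θ, F θ * ∏ i ∈ T, foldFactor (m i) i θ ∂torusMeasure d -
      ∫ θ, F θ ∂torusMeasure d| < ε := by
  induction T using Finset.induction_on generalizing ε with
  | empty => exact ⟨0, by simpa using hε⟩
  | insert i T hi ih =>
    obtain ⟨m, hm⟩ := ih (half_pos hε)
    obtain ⟨k, hk⟩ := exists_abs_integral_foldFactor_lt (memLp_mul_prod_foldFactor hF T m) i
      (half_pos hε)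
    refine ⟨Function.update m i k, ?_⟩
    have h1 : ∀ θ : UnitAddTorus (Fin d),
        F θ * ∏ l ∈ insert i T, foldFactor (Function.update m i k l) l θ =
          F θ * (∏ l ∈ T, foldFactor (m l) l θ) * foldFactor k i θ := fun θ => by
      have h2 : ∏ l ∈ T, foldFactor (Function.update m i k l) l θ =
          ∏ l ∈ T, foldFactor (m l) l θ := Finset.prod_congr rfl fun l hl => by
        have : l ≠ i := fun h => hi (h ▸ hl)
        rw [Function.update_of_ne this]
      rw [Finset.prod_insert hi, Function.update_self, h2]
      ring
    simp only [h1]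
    have := abs_sub_le (∫ θ, F θ * (∏ l ∈ T, foldFactor (m l) l θ) * foldFactor k i θ
      ∂torusMeasure d) (∫ θ, F θ * ∏ l ∈ T, foldFactor (m l) l θ ∂torusMeasure d)
      (∫ θ, F θ ∂torusMeasure d)
    linarith

/-- The Fourier transform of the charge distribution obtained by antisymmetrizing a unit charge
located at distance `m i` from the hyperplane indexed by `i`, for each `i ∈ S`. -/
noncomputable def imageCharges (S : Finset (Fin d)) (m : Fin d → ℕ) :
    C(UnitAddTorus (Fin d), ℂ) :=
  ∏ i ∈ S, (mFourier (Pi.single i (m i : ℤ)) - mFourier (-Pi.single i (m i : ℤ)))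

section ImageCharges

variable (S : Finset (Fin d)) (m : Fin d → ℕ)

theorem imageCharges_apply (θ : UnitAddTorus (Fin d)) : imageCharges S m θ =
    ∏ i ∈ S, (mFourier (Pi.single i (m i : ℤ)) θ - mFourier (-Pi.single i (m i : ℤ)) θ) := by
  simp [imageCharges, ContinuousMap.coe_prod]

theorem imageCharges_neg (θ : UnitAddTorus (Fin d)) :
    imageCharges S m (-θ) = conj (imageCharges S m θ) := by
  simp only [imageCharges_apply, mFourier_neg_right, map_prod, map_sub]

theorem imageCharges_flip {i : Fin d} (hi : i ∈ S) (θ : UnitAddTorus (Fin d)) :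
    imageCharges S m (flip {i} θ) = -imageCharges S m θ := by
  simp only [imageCharges_apply]
  rw [← Finset.mul_prod_erase _ _ hi, ← Finset.mul_prod_erase _ _ hi, ← neg_mul]
  simp only [← mFourier_reflection]
  have h1 : ∀ a : ℤ, reflection i (Pi.single i a) = -(Pi.single i a : Lattice d) := fun a => by
    funext k
    by_cases hk : k = i
    · subst hk; simp [reflection_apply]
    · simp [reflection_apply, hk]
  have h2 : ∀ k ≠ i, ∀ a : ℤ, reflection i (Pi.single k a) = (Pi.single k a : Lattice d) :=
    fun k hk a => by
      rw [reflection_apply, Pi.single_eq_of_ne hk.symm, neg_zero]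
      refine Function.update_eq_self_iff.2 ?_
      rw [Pi.single_eq_of_ne hk.symm]
  congr 1
  · rw [← Pi.single_neg, h1, h1, Pi.single_neg, neg_neg, neg_sub]
  · refine Finset.prod_congr rfl fun k hk => ?_
    rw [← Pi.single_neg, h2 k (Finset.ne_of_mem_erase hk), h2 k (Finset.ne_of_mem_erase hk)]

theorem norm_imageCharges_sq (θ : UnitAddTorus (Fin d)) :
    ‖imageCharges S m θ‖ ^ 2 = 2 ^ S.card * ∏ i ∈ S, foldFactor (m i) i θ := by
  rw [imageCharges_apply, norm_prod, ← Finset.prod_pow, ← Finset.prod_const,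
    ← Finset.prod_mul_distrib]
  refine Finset.prod_congr rfl fun i _ => ?_
  have h1 : mFourier (Pi.single i (2 * m i : ℤ)) θ =
      mFourier (Pi.single i (m i : ℤ)) θ * mFourier (Pi.single i (m i : ℤ)) θ := by
    rw [← mFourier_add, ← Pi.single_add, two_mul]
  have h2 := Complex.sq_norm_sub_sq_re (mFourier (Pi.single i (m i : ℤ)) θ)
  rw [norm_mFourier_apply] at h2
  rw [foldFactor, h1, mFourier_neg, ← Complex.normSq_eq_norm_sq, Complex.normSq_apply]
  simp only [Complex.sub_re, Complex.conj_re, Complex.sub_im, Complex.conj_im, Complex.mul_re]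
  linarith

theorem coef_imageCharges_int (n : Lattice d) : ∃ k : ℤ, coef (imageCharges S m) n = k := by
  have h0 : ⇑(imageCharges S m) = fun θ => ∏ i ∈ S,
    (mFourier (Pi.single i (m i : ℤ)) θ - mFourier (-Pi.single i (m i : ℤ)) θ) :=
    funext (imageCharges_apply S m)
  rw [h0]
  induction S using Finset.induction_on generalizing n with
  | empty =>
    simp only [Finset.prod_empty, coef_one]
    exact ⟨if n = 0 then 1 else 0, by split_ifs <;> simp⟩
  | insert i T hi ih =>
    have ih' := fun n => ih n (funext (imageCharges_apply T m))
    have hc : Integrable (fun θ : UnitAddTorus (Fin d) => ∏ i ∈ T,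
        (mFourier (Pi.single i (m i : ℤ)) θ - mFourier (-Pi.single i (m i : ℤ)) θ))
        (torusMeasure d) := by
      rw [← funext (imageCharges_apply T m)]
      exact integrable_of_continuous (imageCharges T m).continuous
    simp only [Finset.prod_insert hi, sub_mul]
    rw [coef_sub (integrable_mFourier_mul hc _) (integrable_mFourier_mul hc _),
      coef_mFourier_mul, coef_mFourier_mul]
    obtain ⟨a, ha⟩ := ih' (n - Pi.single i (m i : ℤ))
    obtain ⟨b, hb⟩ := ih' (n - -Pi.single i (m i : ℤ))
    exact ⟨a - b, by rw [ha, hb]; push_cast; rfl⟩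

end ImageCharges

theorem coef_reflection {f : UnitAddTorus (Fin d) → ℂ} {i : Fin d}
    (hf : ∀ θ, f (flip {i} θ) = -f θ) (n : Lattice d) : coef f (reflection i n) = -coef f n := by
  unfold coef
  rw [← integral_neg, ← integral_flip {i} fun θ => -(mFourier (-n) θ * f θ)]
  congr 1
  funext θ
  have h : -reflection i n = reflection i (-n) := by
    funext k
    by_cases hk : k = i
    · subst hk; simp [reflection_apply]
    · simp [reflection_apply, hk]
  rw [hf, h, mFourier_reflection]
  ring

/-- The antisymmetrized unit charge, at large distance from the hyperplanes, has square norm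
`2^j (greenEnergy d ± ε)`, of which the fundamental domain carries the fraction `2^(-j)`. The bound
`hsmall` excludes that it is integer valued. -/
theorem gammaOpen_le_add (hd : 16 ≤ d) {j : ℕ} (hj : j ≤ d) {ε : ℝ} (hε : 0 < ε)
    (hε' : ε < greenEnergy d) (hsmall : 2 ^ j * (greenEnergy d + ε) < 1) :
    gammaOpen d j ≤ ENNReal.ofReal (2 * Real.pi ^ 2 * (greenEnergy d + ε)) := by
  have hd1 : 1 ≤ d := by omega
  obtain ⟨S, -, hS⟩ := Finset.exists_subset_card_eq (s := (Finset.univ : Finset (Fin d))) (n := j)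
    (by simpa using hj)
  obtain ⟨m, hm⟩ := exists_abs_integral_prod_foldFactor_lt (memLp_greenChar_sq hd) S hε
  set I := ∫ θ, greenChar d θ ^ 2 * ∏ i ∈ S, foldFactor (m i) i θ ∂torusMeasure d
  have hm' := abs_lt.1 hm
  change -ε < I - greenEnergy d ∧ I - greenEnergy d < ε at hm'
  obtain ⟨ξ, hcoef, hlap, hξ⟩ := exists_solution hd1 (memLp_greenChar hd) (imageCharges S m)
    (imageCharges_neg S m)
  have hI : ∫ θ, greenChar d θ ^ 2 * ‖imageCharges S m θ‖ ^ 2 ∂torusMeasure d = 2 ^ j * I := by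
    rw [← integral_const_mul]
    congr 1
    funext θ
    rw [norm_imageCharges_sq, hS]; ring
  rw [hI] at hξ
  have hanti : AntiSymmetric S ξ := fun i hi x => by
    have h := coef_reflection (f := fun θ => greenChar d θ * imageCharges S m θ) (i := i)
      (fun θ => by rw [greenChar_flip, imageCharges_flip S m hi]; ring) x
    rw [← hcoef, ← hcoef] at h
    exact_mod_cast h
  have hharm : HarmonicModOne ξ := by
    refine ⟨memℓp_two_iff.2 hξ.summable, fun x => ?_⟩
    obtain ⟨k, hk⟩ := coef_imageCharges_int S m x
    rw [← hlap] at hk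
    exact ⟨k, by exact_mod_cast hk⟩
  have h2j : (0 : ℝ) < 2 ^ j := by positivity
  have hne : NonzeroModOne ξ := by
    intro hint
    have h0 := eq_zero_of_int_of_hasSum hξ
      ((mul_le_mul_of_nonneg_left (by linarith) h2j.le).trans_lt hsmall) hint
    have h1 : 2 ^ j * I = 0 := by
      refine hξ.unique ?_
      simp [h0]
    have h2 : 0 < (2 : ℝ) ^ j * I := mul_pos h2j (by linarith)
    linarith
  refine (iInf₂_le S hS).trans ((iInf₂_le ξ ⟨hharm, hanti, hne⟩).trans ?_)
  have hfold := two_pow_mul_tsum_le S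
    (fun x => ENNReal.ofReal (2 * Real.pi ^ 2 * ξ x ^ 2))
    (fun i hi x => by simp only [hanti i hi, neg_sq])
    (fun i hi x hx => by simp [hanti.eq_zero hi hx])
  rw [tsum_ofReal_sq hξ, hS, show 2 * Real.pi ^ 2 * (2 ^ j * I) = 2 ^ j * (2 * Real.pi ^ 2 * I) by
    ring, ENNReal.ofReal_mul h2j.le, ENNReal.ofReal_pow (by norm_num),
    ENNReal.ofReal_ofNat] at hfold
  have hfold' := (ENNReal.mul_le_mul_iff_right (a := 2 ^ j) (by positivity) (by finiteness)).1 hfold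
  refine (ENNReal.tsum_le_tsum fun x => energy_le _).trans (hfold'.trans ?_)
  exact ENNReal.ofReal_le_ofReal (by gcongr; linarith)

/-- Upper bound for the spectral parameters with open boundary, by unit charges escaping from the
reflecting hyperplanes. -/
theorem gammaOpen_le (hd : 16 ≤ d) {j : ℕ} (hj : j ≤ d) (hsmall : 2 ^ j * greenEnergy d < 1) :
    gammaOpen d j ≤ ENNReal.ofReal (2 * Real.pi ^ 2 * greenEnergy d) := by
  have hcont : Continuous fun ε : ℝ =>
      ENNReal.ofReal (2 * Real.pi ^ 2 * (greenEnergy d + ε)) :=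
    ENNReal.continuous_ofReal.comp (by fun_prop)
  have hlim := (hcont.tendsto 0).mono_left (nhdsWithin_le_nhds (s := Set.Ioi 0))
  rw [add_zero] at hlim
  refine ge_of_tendsto hlim ?_
  have hcont2 : Continuous fun ε : ℝ => 2 ^ j * (greenEnergy d + ε) := by fun_prop
  have h1 := (hcont2.tendsto 0).eventually (gt_mem_nhds (by rwa [add_zero]))
  have h2 := gt_mem_nhds (greenEnergy_pos hd)
  filter_upwards [nhdsWithin_le_nhds h1, nhdsWithin_le_nhds h2, self_mem_nhdsWithin]
    with ε h3 h4 h5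
  exact gammaOpen_le_add hd hj h5 h4 h3

/-! ### Asymptotic expansions -/

theorem toReal_mem_of_ofReal {γ : ℝ≥0∞} {L U : ℝ} (hL : ENNReal.ofReal L ≤ γ)
    (hU : γ ≤ ENNReal.ofReal U) (h0 : 0 ≤ U) : L ≤ γ.toReal ∧ γ.toReal ≤ U := by
  have hne : γ ≠ ∞ := ne_top_of_le_ne_top ENNReal.ofReal_ne_top hU
  exact ⟨(ENNReal.ofReal_le_iff_le_toReal hne).1 hL, ENNReal.toReal_le_of_le_ofReal h0 hU⟩

theorem abs_sub_le_of_scaled {c e g x : ℝ} (hc : 0 < c) (hL : c * (x - e) ≤ g)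
    (hU : g ≤ c * (x + e)) : |g / c - x| ≤ e := by
  rw [abs_le]
  constructor
  · have : x - e ≤ g / c := by rw [le_div_iff₀ hc]; linarith
    linarith
  · have : g / c ≤ x + e := by rw [div_le_iff₀ hc]; linarith
    linarith

/-- The expansion of `γ` with periodic boundary condition. The lower bound is applied with the crude
a priori bound `A = 2π² / d²`, twice the leading term, on the energy. -/
theorem exists_abs_gammaPeriodic_sub_le : ∃ C : ℝ, ∀ᶠ d : ℕ in atTop,
    |(gammaPeriodic d).toReal / (Real.pi ^ 2 / (d : ℝ) ^ 2) - (1 + 1 / (2 * (d : ℝ)))| ≤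
      C / (d : ℝ) ^ 2 := by
  obtain ⟨C, hC⟩ := exists_integral_inv_le
  have hpi := Real.pi_pos
  have hpi2 : Real.pi ^ 2 < 9.8698 := by nlinarith [Real.pi_lt_d6]
  refine ⟨max C 100, ?_⟩
  filter_upwards [eventually_ge_atTop 16,
    tendsto_natCast_atTop_atTop.eventually_gt_atTop (3 + |C|)] with d hd hdC
  have hd' : (16 : ℝ) ≤ d := by exact_mod_cast hd
  have hd0 : (0 : ℝ) < d := by linarith
  have hJ := (hC d hd).2.2
  set J := ∫ θ, (1 - stepChar d θ)⁻¹ ∂torusMeasure d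
  have hJ' : J ≤ 1 + 1 / (2 * d) + max C 100 / (d : ℝ) ^ 2 :=
    hJ.trans (by gcongr; exact le_max_left _ _)
  have hsmall : (2 * (d : ℝ) ^ 2)⁻¹ * J < 1 := by
    rw [inv_mul_lt_one₀ (by positivity)]
    have h1 : 1 / (2 * (d : ℝ)) ≤ 1 := by rw [div_le_one (by positivity)]; linarith
    have h2 : C / (d : ℝ) ^ 2 ≤ |C| := by
      rw [div_le_iff₀ (by positivity)]
      exact (le_abs_self C).trans
        (le_mul_of_one_le_right (abs_nonneg C) (one_le_pow₀ (by linarith)))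
    nlinarith [abs_nonneg C]
  have hup := gammaPeriodic_le hd hsmall
  have hlow : ENNReal.ofReal (Real.pi ^ 2 / (d : ℝ) ^ 2 *
      ((1 + 1 / (2 * (d : ℝ))) - max C 100 / (d : ℝ) ^ 2)) ≤ gammaPeriodic d := by
    refine le_trans (ENNReal.ofReal_le_ofReal ?_) (ofReal_le_gammaPeriodic (d := d)
      (A := 2 * Real.pi ^ 2 / (d : ℝ) ^ 2) (L := Real.pi ^ 2 / (d : ℝ) ^ 2 *
      ((1 + 1 / (2 * (d : ℝ))) - 100 / (d : ℝ) ^ 2)) (by omega) ?_ ?_ ?_)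
    · gcongr; exact le_max_right _ _
    · rw [div_lt_one (by positivity)]; nlinarith
    · rw [show 2 * Real.pi ^ 2 / (d : ℝ) ^ 2 = Real.pi ^ 2 / (d : ℝ) ^ 2 * 2 by ring]
      gcongr
      have h1 : 1 / (2 * (d : ℝ)) ≤ 1 := by rw [div_le_one (by positivity)]; linarith
      have h2 : 0 ≤ 100 / (d : ℝ) ^ 2 := by positivity
      linarith
    · obtain ⟨e, he⟩ : ∃ e : ℝ, e = 1 / d := ⟨_, rfl⟩
      have he0 : 0 < e := by rw [he]; positivity
      have he1 : e ≤ 1 / 16 := by rw [he]; gcongr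
      have h1 : Real.pi ^ 2 / (d : ℝ) ^ 2 * ((1 + 1 / (2 * (d : ℝ))) - 100 / (d : ℝ) ^ 2) *
          (2 * (d : ℝ) ^ 2 - d + 100) =
          Real.pi ^ 2 * ((1 + e / 2 - 100 * e ^ 2) * (2 - e + 100 * e ^ 2)) := by
        rw [he]; field_simp
      have h2 : 2 * Real.pi ^ 2 / (d : ℝ) ^ 2 = 2 * Real.pi ^ 2 * e ^ 2 := by
        rw [he]; field_simp
      rw [h1, h2, mul_comm 2, mul_assoc]
      refine mul_le_mul_of_nonneg_left ?_ (by positivity)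
      have h3 : 0 ≤ e ^ 2 := by positivity
      have h4 : 0 ≤ e ^ 2 * (1 / 16 - e) := mul_nonneg h3 (by linarith)
      have h5 : Real.pi ^ 2 * e ^ 2 ≤ 10 * e ^ 2 := by nlinarith
      nlinarith [sq_nonneg (e ^ 2)]
  have hU0 : 0 ≤ 2 * Real.pi ^ 2 * ((2 * (d : ℝ) ^ 2)⁻¹ * J) := by
    have : 0 ≤ J := integral_nonneg fun θ => inv_nonneg.2 (by
      linarith [(abs_le.1 (abs_stepChar_le (d := d) (by omega) θ)).2])
    positivity
  obtain ⟨h1, h2⟩ := toReal_mem_of_ofReal hlow hup hU0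
  refine abs_sub_le_of_scaled (by positivity) h1 (h2.trans ?_)
  rw [show 2 * Real.pi ^ 2 * ((2 * (d : ℝ) ^ 2)⁻¹ * J) = Real.pi ^ 2 / (d : ℝ) ^ 2 * J by
    field_simp]
  gcongr

/-- The expansion of `γ_j` for fixed `j`. The lower bound is applied with the crude a priori bound
`A = 2π² / d²`, four times the leading term, on the energy. -/
theorem exists_abs_gammaOpen_sub_le (j : ℕ) : ∃ C : ℝ, ∀ᶠ d : ℕ in atTop,
    |(gammaOpen d j).toReal / (Real.pi ^ 2 / (2 * (d : ℝ) ^ 2)) - (1 + 3 / (2 * (d : ℝ)))| ≤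
      C / (d : ℝ) ^ 2 := by
  obtain ⟨C, hC⟩ := exists_integral_inv_le
  have hpi := Real.pi_pos
  have hpi2 : Real.pi ^ 2 < 9.8698 := by nlinarith [Real.pi_lt_d6]
  have hj0 : (0 : ℝ) ≤ j := Nat.cast_nonneg _
  refine ⟨max C (10 + 2 * j), ?_⟩
  filter_upwards [eventually_ge_atTop 16, eventually_ge_atTop j,
    tendsto_natCast_atTop_atTop.eventually_gt_atTop (2 ^ j * (3 + |C|))] with d hd hjd hdC
  have hd' : (16 : ℝ) ≤ d := by exact_mod_cast hd
  have hjd' : (j : ℝ) ≤ d := by exact_mod_cast hjd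
  have hd0 : (0 : ℝ) < d := by linarith
  have hJ := (hC d hd).1.2
  have hG := greenEnergy_eq d
  have hG0 := greenEnergy_pos hd
  set J := ∫ θ, ((1 - stepChar d θ) ^ 2)⁻¹ ∂torusMeasure d
  have hJ' : J ≤ 1 + 3 / (2 * d) + max C (10 + 2 * j) / (d : ℝ) ^ 2 :=
    hJ.trans (by gcongr; exact le_max_left _ _)
  have hsmall : 2 ^ j * greenEnergy d < 1 := by
    have h1 : 3 / (2 * (d : ℝ)) ≤ 1 := by rw [div_le_one (by positivity)]; linarith
    have h2 : C / (d : ℝ) ^ 2 ≤ |C| := by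
      rw [div_le_iff₀ (by positivity)]
      exact (le_abs_self C).trans
        (le_mul_of_one_le_right (abs_nonneg C) (one_le_pow₀ (by linarith)))
    have h3 : 2 ^ j * J ≤ 2 ^ j * (3 + |C|) := by gcongr; linarith
    rw [hG, mul_left_comm, inv_mul_lt_one₀ (by positivity)]
    nlinarith
  have hup := gammaOpen_le hd hjd hsmall
  have hlow : ENNReal.ofReal (Real.pi ^ 2 / (2 * (d : ℝ) ^ 2) *
      ((1 + 3 / (2 * (d : ℝ))) - max C (10 + 2 * j) / (d : ℝ) ^ 2)) ≤ gammaOpen d j := by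
    refine le_trans (ENNReal.ofReal_le_ofReal ?_) (ofReal_le_gammaOpen (d := d) (j := j)
      (R := 4 * d ^ 2 - 6 * d + 4 * j + 12)
      (A := 2 * Real.pi ^ 2 / (d : ℝ) ^ 2) (L := Real.pi ^ 2 / (2 * (d : ℝ) ^ 2) *
      ((1 + 3 / (2 * (d : ℝ))) - (10 + 2 * j) / (d : ℝ) ^ 2)) (by omega) ?_ ?_ ?_ ?_ ?_)
    · gcongr; exact le_max_right _ _
    · nlinarith
    · have h1 : (2 * d - j : ℝ) * (2 * d + 2 * (2 * d - j) - 2) / d ^ 2 ≤ 12 := by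
        rw [div_le_iff₀ (by positivity)]; nlinarith
      linarith
    · rw [div_lt_one (by positivity)]; nlinarith
    · rw [show 2 * Real.pi ^ 2 / (d : ℝ) ^ 2 = Real.pi ^ 2 / (2 * (d : ℝ) ^ 2) * 4 by
        field_simp; norm_num]
      gcongr
      have h1 : 3 / (2 * (d : ℝ)) ≤ 1 := by rw [div_le_one (by positivity)]; linarith
      have h2 : 0 ≤ (10 + 2 * j) / (d : ℝ) ^ 2 := by positivity
      linarith
    · obtain ⟨e, he⟩ : ∃ e : ℝ, e = 1 / d := ⟨_, rfl⟩
      have he0 : 0 < e := by rw [he]; positivity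
      have he1 : e ≤ 1 / 16 := by rw [he]; gcongr
      have h1 : Real.pi ^ 2 / (2 * (d : ℝ) ^ 2) *
          ((1 + 3 / (2 * (d : ℝ))) - (10 + 2 * j) / (d : ℝ) ^ 2) *
          (4 * d ^ 2 - 6 * d + 4 * j + 12) = 2 * Real.pi ^ 2 *
          ((1 + 3 / 2 * e - (10 + 2 * j) * e ^ 2) * (1 - 3 / 2 * e + (j + 3) * e ^ 2)) := by
        rw [he]; field_simp; ring
      have h2 : 2 * Real.pi ^ 2 / (d : ℝ) ^ 2 = 2 * Real.pi ^ 2 * e ^ 2 := by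
        rw [he]; field_simp
      rw [h1, h2]
      refine mul_le_mul_of_nonneg_left ?_ (by positivity)
      have h3 : 0 ≤ e ^ 2 := by positivity
      have h4 : 0 ≤ e ^ 2 * (1 / 16 - e) := mul_nonneg h3 (by linarith)
      have h5 : Real.pi ^ 2 * e ^ 2 ≤ 10 * e ^ 2 := by nlinarith
      have h6 : 0 ≤ (j : ℝ) * (e ^ 2 * (1 / 16 - e)) := mul_nonneg hj0 h4
      have h7 : 0 ≤ (j : ℝ) * e ^ 2 := by positivity
      have h8 : 0 ≤ (10 + 2 * j) * (j + 3) * e ^ 4 := by positivity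
      nlinarith
  have hU0 : 0 ≤ 2 * Real.pi ^ 2 * greenEnergy d := by positivity
  obtain ⟨h1, h2⟩ := toReal_mem_of_ofReal hlow hup hU0
  refine abs_sub_le_of_scaled (by positivity) h1 (h2.trans ?_)
  rw [hG,
    show 2 * Real.pi ^ 2 * ((4 * (d : ℝ) ^ 2)⁻¹ * J) = Real.pi ^ 2 / (2 * (d : ℝ) ^ 2) * J by
    field_simp; norm_num]
  gcongr

/-- The expansion of the spectral factor `Γ_j` for fixed `j`. -/
theorem exists_abs_spectralFactor_sub_le (j : ℕ) : ∃ C : ℝ, ∀ᶠ d : ℕ in atTop,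
    |Real.pi ^ 2 * spectralFactor d j - (2 * (d : ℝ) ^ 3 - (2 * (j : ℝ) + 3) * (d : ℝ) ^ 2)| ≤
      C * d := by
  obtain ⟨C, hC⟩ := exists_abs_gammaOpen_sub_le j
  have hj0 : (0 : ℝ) ≤ j := Nat.cast_nonneg _
  refine ⟨2 * (2 * |C| + 3 / 2 * (2 * j + 3) + (2 * j + 3) * |C|), ?_⟩
  -- `D` is `γ_j` divided by its leading term, and `d² δ` is bounded
  filter_upwards [hC, eventually_ge_atTop 1,
    tendsto_natCast_atTop_atTop.eventually_gt_atTop (2 * |C|)] with d h hd hdC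
  have hd' : (1 : ℝ) ≤ d := by exact_mod_cast hd
  have hd0 : (0 : ℝ) < d := by linarith
  have hpi := Real.pi_pos
  obtain ⟨δ, hδ⟩ : ∃ δ : ℝ, δ = (gammaOpen d j).toReal / (Real.pi ^ 2 / (2 * (d : ℝ) ^ 2)) -
    (1 + 3 / (2 * (d : ℝ))) := ⟨_, rfl⟩
  rw [← hδ] at h
  have hδ2 : (d : ℝ) ^ 2 * |δ| ≤ |C| := by
    rw [le_div_iff₀ (by positivity)] at h
    linarith [le_abs_self C]
  have hδ1 : |δ| ≤ 1 / 2 := by nlinarith [abs_nonneg δ]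
  set D : ℝ := 1 + 3 / (2 * (d : ℝ)) + δ with hD
  have hD2 : 1 / 2 ≤ D := by
    have h1 : 0 ≤ 3 / (2 * (d : ℝ)) := by positivity
    linarith [(abs_le.1 hδ1).1]
  have hg : (gammaOpen d j).toReal = Real.pi ^ 2 / (2 * (d : ℝ) ^ 2) * D := by
    rw [hD, hδ]; field_simp; ring
  have hΓ : Real.pi ^ 2 * spectralFactor d j -
      (2 * (d : ℝ) ^ 3 - (2 * (j : ℝ) + 3) * (d : ℝ) ^ 2) =
      (-(2 * d * (d ^ 2 * δ)) + 3 / 2 * (2 * j + 3) * d + (2 * j + 3) * (d ^ 2 * δ)) / D := by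
    have hD0 : D ≠ 0 := by linarith
    rw [spectralFactor, hg, eq_div_iff hD0]
    have h1 : Real.pi ^ 2 * (((d : ℝ) - j) / (Real.pi ^ 2 / (2 * (d : ℝ) ^ 2) * D)) * D =
        2 * d ^ 2 * (d - j) := by field_simp
    rw [sub_mul, h1, hD]
    field_simp
    ring
  rw [hΓ, abs_div, abs_of_pos (by linarith : 0 < D), div_le_iff₀ (by linarith)]
  have hw : |(d : ℝ) ^ 2 * δ| ≤ |C| := by rwa [abs_mul, abs_of_nonneg (by positivity)]
  have h1 : |(-(2 * d * (d ^ 2 * δ)) + 3 / 2 * (2 * j + 3) * d + (2 * j + 3) * (d ^ 2 * δ))| ≤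
      2 * d * |C| + 3 / 2 * (2 * j + 3) * d + (2 * j + 3) * |C| := by
    refine (abs_add_three _ _ _).trans ?_
    rw [abs_neg, abs_mul, abs_mul (2 * (j : ℝ) + 3),
      abs_of_nonneg (by positivity : (0 : ℝ) ≤ 2 * d),
      abs_of_nonneg (by positivity : (0 : ℝ) ≤ 2 * j + 3),
      abs_of_nonneg (by positivity : (0 : ℝ) ≤ 3 / 2 * (2 * j + 3) * d)]
    gcongr
  refine h1.trans ?_
  have h2 : (2 * j + 3) * |C| ≤ (2 * j + 3) * |C| * d :=
    le_mul_of_one_le_right (by positivity) hd'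
  have h3 : 0 ≤ (2 * |C| + 3 / 2 * (2 * j + 3) + (2 * j + 3) * |C|) * d := by positivity
  nlinarith

/-- The uniform upper bound for the spectral factors. An infinite `γ_j` has `toReal` zero, and then
`Γ_j` is zero. -/
theorem spectralFactor_le {d j : ℕ} (hd : 2 ≤ d) (hj : j < d) :
    Real.pi ^ 2 * spectralFactor d j ≤ (d - j) * (2 * (d : ℝ) ^ 2 + d) := by
  have hpi := Real.pi_pos
  have hd0 : (0 : ℝ) < d := by exact_mod_cast (by omega : 0 < d)
  have hj' : (j : ℝ) ≤ d := by exact_mod_cast hj.le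
  have h := pi_sq_div_le_gammaOpen hd hj
  by_cases htop : gammaOpen d j = ∞
  · rw [spectralFactor, htop, ENNReal.toReal_top, div_zero, mul_zero]
    exact mul_nonneg (by linarith) (by positivity)
  · rw [ENNReal.ofReal_le_iff_le_toReal htop] at h
    have hpos : 0 < Real.pi ^ 2 / (2 * (d : ℝ) ^ 2 + d) := by positivity
    rw [spectralFactor, mul_div_assoc', div_le_iff₀ (hpos.trans_le h)]
    have h1 := mul_le_mul_of_nonneg_left h
      (mul_nonneg (by linarith) (by positivity) : 0 ≤ ((d : ℝ) - j) * (2 * (d : ℝ) ^ 2 + d))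
    refine le_trans (le_of_eq ?_) h1
    field_simp

/-- For large dimension the bulk dominates: three or more hyperplanes are excluded by the uniform
bound, one or two by the expansions of `Γ_0`, `Γ_1` and `Γ_2`. -/
theorem eventually_bulkControlsMixing : ∀ᶠ d : ℕ in atTop, BulkControlsMixing d := by
  obtain ⟨C₀, h₀⟩ := exists_abs_spectralFactor_sub_le 0
  obtain ⟨C₁, h₁⟩ := exists_abs_spectralFactor_sub_le 1
  obtain ⟨C₂, h₂⟩ := exists_abs_spectralFactor_sub_le 2
  filter_upwards [h₀, h₁, h₂, eventually_ge_atTop 3,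
    tendsto_natCast_atTop_atTop.eventually_gt_atTop (|C₀| + |C₁| + |C₂|)] with d h₀ h₁ h₂ hd hdC
  have hd' : (3 : ℝ) ≤ d := by exact_mod_cast hd
  have hpi := Real.pi_pos
  have hle : ∀ j < d, spectralFactor d j ≤ spectralFactor d 0 := by
    intro j hj
    have hj' : (j : ℝ) ≤ d := by exact_mod_cast hj.le
    have a0 := le_abs_self C₀
    have a1 := le_abs_self C₁
    have a2 := le_abs_self C₂
    have b0 := abs_nonneg C₀
    have b1 := abs_nonneg C₁
    have b2 := abs_nonneg C₂
    have e0 := (abs_le.1 h₀).1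
    have e1 := (abs_le.1 h₁).2
    have e2 := (abs_le.1 h₂).2
    have hdd : (|C₀| + |C₁| + |C₂|) * d ≤ d * d := by nlinarith
    have c0 : C₀ * d ≤ |C₀| * d := by nlinarith
    have c1 : C₁ * d ≤ |C₁| * d := by nlinarith
    have c2 : C₂ * d ≤ |C₂| * d := by nlinarith
    have d0 : 0 ≤ |C₀| * d := by positivity
    have d1 : 0 ≤ |C₁| * d := by positivity
    have d2 : 0 ≤ |C₂| * d := by positivity
    refine le_of_mul_le_mul_left ?_ (by positivity : 0 < Real.pi ^ 2)
    push_cast at e0 e1 e2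
    rcases (by omega : j = 0 ∨ j = 1 ∨ j = 2 ∨ 3 ≤ j) with rfl | rfl | rfl | h3
    · exact le_rfl
    · nlinarith
    · nlinarith
    · have h3' : (3 : ℝ) ≤ j := by exact_mod_cast h3
      have e3 := spectralFactor_le (by omega) hj
      have e4 : ((d : ℝ) - j) * (2 * (d : ℝ) ^ 2 + d) ≤ (d - 3) * (2 * (d : ℝ) ^ 2 + d) := by
        gcongr
      nlinarith
  have : Nonempty (Fin d) := ⟨⟨0, by omega⟩⟩
  refine le_antisymm (ciSup_le fun j => hle j j.2) ?_
  exact le_ciSup (f := fun j : Fin d => spectralFactor d j) (Set.finite_range _).bddAbove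
    ⟨0, by omega⟩

theorem isBigO_inv_sq_of_abs_le {E : ℕ → ℝ} {C : ℝ}
    (h : ∀ᶠ d : ℕ in atTop, |E d| ≤ C / (d : ℝ) ^ 2) :
    E =O[atTop] fun d : ℕ => ((d : ℝ) ^ 2)⁻¹ := by
  refine IsBigO.of_bound C ?_
  filter_upwards [h] with d hd
  rwa [Real.norm_eq_abs, Real.norm_of_nonneg (by positivity), ← div_eq_mul_inv]

end ZdSandpile

theorem theorem3 :
    (∃ E : ℕ → ℝ, E =O[atTop] (fun d : ℕ => ((d : ℝ) ^ 2)⁻¹) ∧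
      ∀ᶠ d : ℕ in atTop, (ZdSandpile.gammaPeriodic d).toReal =
        Real.pi ^ 2 / (d : ℝ) ^ 2 * (1 + 1 / (2 * (d : ℝ)) + E d)) ∧
    (∀ j : ℕ, ∃ E : ℕ → ℝ, E =O[atTop] (fun d : ℕ => ((d : ℝ) ^ 2)⁻¹) ∧
      ∀ᶠ d : ℕ in atTop, (ZdSandpile.gammaOpen d j).toReal =
        Real.pi ^ 2 / (2 * (d : ℝ) ^ 2) * (1 + 3 / (2 * (d : ℝ)) + E d)) ∧
    (∀ d : ℕ, 2 ≤ d → ∀ j : ℕ, j < d →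
      ENNReal.ofReal (Real.pi ^ 2 / (2 * (d : ℝ) ^ 2 + d)) ≤ ZdSandpile.gammaOpen d j) ∧
    (∀ j : ℕ, ∃ E : ℕ → ℝ, E =O[atTop] (fun d : ℕ => (d : ℝ)) ∧
      ∀ᶠ d : ℕ in atTop, ZdSandpile.spectralFactor d j =
        (2 * (d : ℝ) ^ 3 - (2 * (j : ℝ) + 3) * (d : ℝ) ^ 2 + E d) / Real.pi ^ 2) ∧
    (∀ᶠ d : ℕ in atTop, ZdSandpile.BulkControlsMixing d) ∧
    (∃ E : ℕ → ℝ, E =O[atTop] (fun d : ℕ => ((d : ℝ) ^ 2)⁻¹) ∧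
      ∀ᶠ d : ℕ in atTop, ZdSandpile.maxSpectralFactor d =
        2 * (d : ℝ) ^ 3 / Real.pi ^ 2 * (1 - 3 / (2 * (d : ℝ)) + E d)) := by
  refine ⟨?_, fun j => ?_, fun d hd j hj => ZdSandpile.pi_sq_div_le_gammaOpen hd hj, fun j => ?_,
    ZdSandpile.eventually_bulkControlsMixing, ?_⟩
  · obtain ⟨C, hC⟩ := ZdSandpile.exists_abs_gammaPeriodic_sub_le
    refine ⟨_, ZdSandpile.isBigO_inv_sq_of_abs_le hC, ?_⟩
    filter_upwards [eventually_ge_atTop 1] with d hd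
    have hd0 : (d : ℝ) ≠ 0 := by exact_mod_cast (by omega : d ≠ 0)
    have hpi := Real.pi_pos
    field_simp
    ring
  · obtain ⟨C, hC⟩ := ZdSandpile.exists_abs_gammaOpen_sub_le j
    refine ⟨_, ZdSandpile.isBigO_inv_sq_of_abs_le hC, ?_⟩
    filter_upwards [eventually_ge_atTop 1] with d hd
    have hd0 : (d : ℝ) ≠ 0 := by exact_mod_cast (by omega : d ≠ 0)
    have hpi := Real.pi_pos
    field_simp
    ring
  · obtain ⟨C, hC⟩ := ZdSandpile.exists_abs_spectralFactor_sub_le j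
    refine ⟨fun d => Real.pi ^ 2 * ZdSandpile.spectralFactor d j -
      (2 * (d : ℝ) ^ 3 - (2 * (j : ℝ) + 3) * (d : ℝ) ^ 2), IsBigO.of_bound C ?_, ?_⟩
    · filter_upwards [hC] with d hd
      rwa [Real.norm_eq_abs, Real.norm_of_nonneg (Nat.cast_nonneg _)]
    · filter_upwards with d
      have hpi := Real.pi_pos
      field_simp
      ring
  · obtain ⟨C, hC⟩ := ZdSandpile.exists_abs_spectralFactor_sub_le 0
    refine ⟨fun d => (Real.pi ^ 2 * ZdSandpile.spectralFactor d 0 -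
      (2 * (d : ℝ) ^ 3 - 3 * (d : ℝ) ^ 2)) / (2 * (d : ℝ) ^ 3), ZdSandpile.isBigO_inv_sq_of_abs_le (C := C / 2) ?_, ?_⟩
    · filter_upwards [hC, eventually_ge_atTop 1] with d hd hd1
      have hd0 : (0 : ℝ) < d := by exact_mod_cast hd1
      rw [abs_div, abs_of_pos (by positivity : (0 : ℝ) < 2 * (d : ℝ) ^ 3),
        div_le_iff₀ (by positivity)]
      simp only [Nat.cast_zero, mul_zero, zero_add] at hd
      refine hd.trans (le_of_eq ?_)
      field_simp
    · filter_upwards [ZdSandpile.eventually_bulkControlsMixing, eventually_ge_atTop 1] with d hd hd1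
      have hd0 : (0 : ℝ) < d := by exact_mod_cast hd1
      have hpi := Real.pi_pos
      rw [show ZdSandpile.maxSpectralFactor d = ZdSandpile.spectralFactor d 0 from hd]
      field_simp
      ring
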